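/- Let $c>0$, let $1\le k\le\infty$, and consider a damped wave equation $$u_{tt}+g(t,x,u,u_t)=c^2u_{xx},\qquad g_{u_t}\not\equiv 0,$$ whose nonlinearity $g$ is non-singular, meaning that it is a $C^k$ function on all of $\mathbb{R}^4$. Say that the equation possesses an energy-momentum type conservation law if there are constants $a,b$ and $c_0,c_1,c_2$ (the latter three not all zero), a $C^k$ function $C(t,x,u,u_x)$, and a $C^k$ flux $\Psi$ depending on $t$, $x$, $u$, $u_t$ and finitely many $x$-derivatives of $u$ and $u_t$, such that for $$T=e^{at+bx}\big(\tfrac12c_1u_t^2+c_2u_xu_t+c_0uu_t\big)+C(t,x,u,u_x),\qquad Q=\frac{\partial T}{\partial u_t}=e^{at+bx}(c_1u_t+c_2u_x+c_0u)$$ the identity $$\big(u_{tt}-c^2u_{xx}+g(t,x,u,u_t)\big)\,Q=D_tT+D_x\Psi$$ holds for every smooth function $u(t,x)$ on $\mathbb{R}^2$; so $\int T\,dx$ is a conserved integral with multiplier $Q$. Theorem. The equation possesses an energy-momentum type conservation law if and only if, for some constant $\alpha$, it has linear damping with coefficient $\alpha$, i.e. $g=\alpha u_t+f_0(t,x,u)$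 for some function $f_0$, and the point transformation $u=e^{-\alpha t/2}v$ maps it into an undamped wave equation $$v_{tt}+\tilde g(t,x,v)=c^2v_{xx}$$ whose nonlinearity has one of the forms $$\text{(i)}\ \tilde g=f(t,v);\qquad \text{(ii)}\ \tilde g=f(x-\tilde c\,t,v);\qquad \text{(iii)}\ \tilde g=e^{\pm2cbt}f(x\pm ct,v)\ \text{(same sign in both places)},$$ with constants $\tilde c,b\in\mathbb{R}$ and an arbitrary function $f$ of two variables. -/

import Mathlib

open scoped ContDiff

noncomputable section

namespace DampedWave

/-- The partial derivative `u_t` of a field `u(t, x)`. -/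
def dt (u : ℝ → ℝ → ℝ) : ℝ → ℝ → ℝ := fun t x => deriv (fun s => u s x) t

/-- The partial derivative `u_x` of a field `u(t, x)`. -/
def dx (u : ℝ → ℝ → ℝ) : ℝ → ℝ → ℝ := fun t x => deriv (fun y => u t y) x

/-- Smooth fields `u(t, x)` on the `(t, x)`-plane. -/
def SmoothField (u : ℝ → ℝ → ℝ) : Prop :=
  ContDiff ℝ ∞ (fun p : ℝ × ℝ => u p.1 p.2)

/-- `g(t, x, u, u_t)` is non-singular: it is defined and of class `C^k` for all values of its
four arguments. -/
def NonSingular (k : ℕ∞) (g : ℝ → ℝ → ℝ → ℝ → ℝ) : Prop :=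
  ContDiff ℝ k (fun z : ℝ × ℝ × ℝ × ℝ => g z.1 z.2.1 z.2.2.1 z.2.2.2)

/-- `g(t, x, u, u_t)` contains damping: `g_{u_t}` does not vanish identically. -/
def HasDamping (g : ℝ → ℝ → ℝ → ℝ → ℝ) : Prop :=
  ∃ t x u p : ℝ, deriv (fun p' => g t x u p') p ≠ 0

/-- The left-hand side of `u_tt - c² u_xx + g(t, x, u, u_t) = 0`, for a field `u`, at `(t, x)`. -/
def waveExpr (c : ℝ) (g : ℝ → ℝ → ℝ → ℝ → ℝ) (u : ℝ → ℝ → ℝ) (t x : ℝ) : ℝ :=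
  dt (dt u) t x - c ^ 2 * dx (dx u) t x + g t x (u t x) (dt u t x)

/-- The left-hand side of the undamped `v_tt - c² v_xx + G(t, x, v) = 0`, for a field `v`,
at `(t, x)`. -/
def undampedExpr (c : ℝ) (G : ℝ → ℝ → ℝ → ℝ) (v : ℝ → ℝ → ℝ) (t x : ℝ) : ℝ :=
  waveExpr c (fun t x v _ => G t x v) v t x

/-- The multiplier `Q = e^{a t + b x} (c₁ u_t + c₂ u_x + c₀ u)`, along a field `u`. -/
def multiplier (a b c₀ c₁ c₂ : ℝ) (u : ℝ → ℝ → ℝ) (t x : ℝ) : ℝ :=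
  Real.exp (a * t + b * x) * (c₁ * dt u t x + c₂ * dx u t x + c₀ * u t x)

/-- The energy-momentum density
`T = e^{a t + b x} (½ c₁ u_t² + c₂ u_x u_t + c₀ u u_t) + C(t, x, u, u_x)`, along a field `u`. -/
def density (a b c₀ c₁ c₂ : ℝ) (C : ℝ → ℝ → ℝ → ℝ → ℝ) (u : ℝ → ℝ → ℝ) (t x : ℝ) : ℝ :=
  Real.exp (a * t + b * x) *
      (1 / 2 * c₁ * dt u t x ^ 2 + c₂ * dx u t x * dt u t x + c₀ * u t x * dt u t x)
    + C t x (u t x) (dx u t x)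

/-- A spatial flux `Ψ` that depends on `t`, `x`, and on the `x`-derivatives of `u` and of `u_t`
up to some finite order `N` (order `0` being `u` and `u_t` themselves), along a field `u`. -/
def flux {N : ℕ} (Ψ : ℝ → ℝ → (Fin (N + 1) → ℝ) → (Fin (N + 1) → ℝ) → ℝ)
    (u : ℝ → ℝ → ℝ) (t x : ℝ) : ℝ :=
  Ψ t x (fun i => (dx^[(i : ℕ)] u) t x) (fun i => (dx^[(i : ℕ)] (dt u)) t x)

/-- The wave equation `u_tt + g(t, x, u, u_t) = c² u_xx` possesses an energy-momentum type
conservation law (of class `C^k`): for some constants `a`, `b` and `c₀`, `c₁`, `c₂`, the latter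
not all zero, some function `C(t, x, u, u_x)` and some flux `Ψ`, the identity
`(u_tt - c² u_xx + g) Q = D_t T + D_x Ψ` holds with the energy-momentum density `T` and its
multiplier `Q = ∂T/∂u_t`. The identity is required off the solution space, that is along every
smooth field. -/
def HasEnergyMomentumLaw (k : ℕ∞) (c : ℝ) (g : ℝ → ℝ → ℝ → ℝ → ℝ) : Prop :=
  ∃ (a b c₀ c₁ c₂ : ℝ) (C : ℝ → ℝ → ℝ → ℝ → ℝ) (N : ℕ)
    (Ψ : ℝ → ℝ → (Fin (N + 1) → ℝ) → (Fin (N + 1) → ℝ) → ℝ),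
    ¬ (c₀ = 0 ∧ c₁ = 0 ∧ c₂ = 0) ∧
    ContDiff ℝ k (fun z : ℝ × ℝ × ℝ × ℝ => C z.1 z.2.1 z.2.2.1 z.2.2.2) ∧
    ContDiff ℝ k (fun z : ℝ × ℝ × (Fin (N + 1) → ℝ) × (Fin (N + 1) → ℝ) =>
      Ψ z.1 z.2.1 z.2.2.1 z.2.2.2) ∧
    ∀ u : ℝ → ℝ → ℝ, SmoothField u → ∀ t x : ℝ,
      waveExpr c g u t x * multiplier a b c₀ c₁ c₂ u t x
        = dt (density a b c₀ c₁ c₂ C u) t x + dx (flux Ψ u) t x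

/-- `g` has linear damping with constant coefficient `α`: `g = α u_t + f(t, x, u)`. -/
def HasLinearDamping (α : ℝ) (g : ℝ → ℝ → ℝ → ℝ → ℝ) : Prop :=
  ∃ f : ℝ → ℝ → ℝ → ℝ, ∀ t x u p : ℝ, g t x u p = α * p + f t x u

/-- The point transformation `u = e^{-(α/2) t} v` maps `u_tt + g(t, x, u, u_t) = c² u_xx` into
`v_tt + G(t, x, v) = c² v_xx`: at each point, a field `v` satisfies the latter equation exactly
when the corresponding `u` satisfies the former. -/
def MapsToUndamped (c α : ℝ) (g : ℝ → ℝ → ℝ → ℝ → ℝ) (G : ℝ → ℝ → ℝ → ℝ) : Prop :=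
  ∀ v : ℝ → ℝ → ℝ, SmoothField v → ∀ t x : ℝ,
    waveExpr c g (fun t x => Real.exp (-(α / 2) * t) * v t x) t x = 0 ↔ undampedExpr c G v t x = 0

/-- The three forms of the nonlinearity `G(t, x, v)` of the undamped wave equation:
* `G = f(t, v)`;
* `G = f(x - c' t, v)` with a constant `c'`;
* `G = e^{± 2 c b t} f(x ± c t, v)` with a constant `b` (same sign in both places),

where `f` is an arbitrary function of its two arguments. -/
def EnergyMomentumForm (c : ℝ) (G : ℝ → ℝ → ℝ → ℝ) : Prop :=
  (∃ f : ℝ → ℝ → ℝ, ∀ t x v : ℝ, G t x v = f t v) ∨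
  (∃ (c' : ℝ) (f : ℝ → ℝ → ℝ), ∀ t x v : ℝ, G t x v = f (x - c' * t) v) ∨
  (∃ (s b : ℝ) (f : ℝ → ℝ → ℝ), (s = 1 ∨ s = -1) ∧
    ∀ t x v : ℝ, G t x v = Real.exp (2 * s * c * b * t) * f (x + s * c * t) v)

end DampedWave

end

/-! Sufficiency. If `g = α u_t + f(t,x,u)`, put `v = e^{αt/2} u`; the equation for `v` has a
nonlinearity `G` with a potential. The three forms say together that `G` is invariant, up to an
exponential factor, under the flow of `c₁∂_t + c₂∂_x`, with an accompanying exponent `At + bx`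
subject to `A c₁ = b c₂` and `A c₂ = c² b c₁` (`energyMomentumForm_iff`). Integrated in `v`, this
symmetry is a first-order linear PDE for the `u`-primitive of `f` (`symmetry_iff_pde`). The weighted
energy-momentum density of `v`, rewritten in `u`, is then conserved: the PDE cancels the terms with
the potential, the two relations the remaining ones.

Necessity. The identity is tested on fields affine in `t` with polynomial coefficients, for which
the jets of `u` and `u_t` at a point are arbitrary and independent. Descending through the jet
orders, the flux depends only on `t, x, u, u_x, u_t` (`exists_low_order_flux`). The coefficients of
`u_xx` and `u_tx` then fix `C` and the flux up to three functions `A₀, A₁, B₀` of `(t,x,u)`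
(`exists_potentials`), and what remains is polynomial in `u_x`. Splitting it makes `g` affine in
`u_t` with constant slope; when `c₂ = 0` this needs continuity of `g` in `u_t`, which rules out a
pole where the multiplier vanishes (`linear_damping_of_determining_equation`). The remaining
coefficients are the components of a curl of `(A₀, A₁, B₀)`, so their divergence vanishes.
Integrated once in `u`, so that `C¹` data suffice (`integrated_div_curl`), this is the same PDE,
hence the symmetry. -/

noncomputable section

namespace DampedWave

/-! ### Smoothness of parametric integrals and of primitives in `u` -/

section ParametricIntegral

variable {H E : Type} [NormedAddCommGroup H] [NormedSpace ℝ H] [ProperSpace H]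
  [NormedAddCommGroup E] [NormedSpace ℝ E]

/-- Differentiation of a `C¹` integrand under an interval integral. -/
theorem hasFDerivAt_parametric_intervalIntegral {f : H × ℝ → E} (hf : ContDiff ℝ 1 f)
    (a b : ℝ) (x₀ : H) :
    HasFDerivAt (fun x => ∫ s in a..b, f (x, s))
      (∫ s in a..b, (fderiv ℝ f (x₀, s)).comp (ContinuousLinearMap.inl ℝ H ℝ)) x₀ := by
  have hc : Continuous fun z : H × ℝ =>
      (fderiv ℝ f z).comp (ContinuousLinearMap.inl ℝ H ℝ) :=
    (hf.continuous_fderiv one_ne_zero).clm_comp continuous_const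
  have hcs : ∀ x : H, Continuous fun s : ℝ =>
      (fderiv ℝ f (x, s)).comp (ContinuousLinearMap.inl ℝ H ℝ) := fun x =>
    hc.comp (by fun_prop : Continuous fun s : ℝ => (x, s))
  have hfs : ∀ x : H, Continuous fun s : ℝ => f (x, s) := fun x =>
    hf.continuous.comp (by fun_prop : Continuous fun s : ℝ => (x, s))
  -- Closed balls of `H` are compact, so a constant dominates the derivative near `x₀`.
  obtain ⟨K, hK⟩ := ((isCompact_closedBall x₀ 1).prod
    (isCompact_uIcc (a := a) (b := b))).exists_bound_of_continuousOn hc.continuousOn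
  refine intervalIntegral.hasFDerivAt_integral_of_dominated_of_fderiv_le (𝕜 := ℝ)
    (F := fun x s => f (x, s))
    (F' := fun x s => (fderiv ℝ f (x, s)).comp (ContinuousLinearMap.inl ℝ H ℝ))
    (bound := fun _ => K) (Metric.closedBall_mem_nhds x₀ one_pos) ?_ ?_ ?_ ?_ ?_ ?_
  · exact .of_forall fun x => (hfs x).aestronglyMeasurable
  · exact (hfs x₀).intervalIntegrable a b
  · exact (hcs x₀).aestronglyMeasurable
  · exact .of_forall fun s hs x hx => hK (x, s) ⟨hx, Set.uIoc_subset_uIcc hs⟩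
  · exact continuous_const.intervalIntegrable a b
  · refine .of_forall fun s _ x _ => ?_
    exact ((hf.differentiable one_ne_zero) (x, s)).hasFDerivAt.comp x
      (hasFDerivAt_prodMk_left x s)

/-- Each differentiation replaces the target `E` by the continuous linear maps `H →L[ℝ] E`, so the
induction on `n` must quantify over `E`. -/
theorem contDiff_nat_parametric_intervalIntegral (n : ℕ) :
    ∀ {E : Type} [NormedAddCommGroup E] [NormedSpace ℝ E] [CompleteSpace E] {f : H × ℝ → E},
      ContDiff ℝ n f → ∀ a b : ℝ, ContDiff ℝ n (fun x => ∫ s in a..b, f (x, s)) := by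
  induction n with
  | zero =>
    intro E _ _ _ f hf a b
    have h0 : Continuous (Function.uncurry fun (x : H) (s : ℝ) => f (x, s)) := hf.continuous
    exact contDiff_zero.2
      (intervalIntegral.continuous_parametric_intervalIntegral_of_continuous' h0 a b)
  | succ n ih =>
    intro E _ _ _ f hf a b
    have h1 : ContDiff ℝ 1 f := hf.of_le (by exact_mod_cast Nat.le_add_left 1 n)
    have hd : ∀ x, HasFDerivAt (fun x => ∫ s in a..b, f (x, s)) _ x :=
      hasFDerivAt_parametric_intervalIntegral h1 a b
    have hcast : ((n + 1 : ℕ) : WithTop ℕ∞) = (n : WithTop ℕ∞) + 1 := by push_cast; rfl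
    rw [hcast] at hf ⊢
    rw [contDiff_succ_iff_fderiv]
    refine ⟨fun x => (hd x).differentiableAt, by simp, ?_⟩
    rw [funext fun x => (hd x).fderiv]
    refine ih (f := fun z : H × ℝ =>
      (fderiv ℝ f z).comp (ContinuousLinearMap.inl ℝ H ℝ)) ?_ a b
    exact ((contDiff_succ_iff_fderiv.1 hf).2.2).clm_comp contDiff_const

/-- An interval integral depending on a parameter is as smooth as its integrand. -/
theorem contDiff_parametric_intervalIntegral [CompleteSpace E] {k : ℕ∞} {f : H × ℝ → E}
    (hf : ContDiff ℝ k f) (a b : ℝ) : ContDiff ℝ k (fun x => ∫ s in a..b, f (x, s)) :=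
  contDiff_iff_forall_nat_le.2 fun m hm =>
    contDiff_nat_parametric_intervalIntegral m (hf.of_le (by exact_mod_cast hm)) a b

end ParametricIntegral

/-- The primitive in the last variable, normalised to vanish at `0`. -/
def primitive (f : ℝ → ℝ → ℝ → ℝ) (t x u : ℝ) : ℝ := ∫ s in (0 : ℝ)..u, f t x s

/-- The substitution `s = r u` turns the moving endpoint into a parameter of an integral over `[0,
1]`. -/
theorem contDiff_primitive {k : ℕ∞} {f : ℝ → ℝ → ℝ → ℝ}
    (hf : ContDiff ℝ k fun z : ℝ × ℝ × ℝ => f z.1 z.2.1 z.2.2) :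
    ContDiff ℝ k fun z : ℝ × ℝ × ℝ => primitive f z.1 z.2.1 z.2.2 := by
  have h : (fun z : ℝ × ℝ × ℝ => primitive f z.1 z.2.1 z.2.2)
      = fun z => ∫ r in (0 : ℝ)..1, z.2.2 * f z.1 z.2.1 (r * z.2.2) := by
    funext z
    simp [primitive]
  rw [h]
  refine contDiff_parametric_intervalIntegral
    (f := fun w : (ℝ × ℝ × ℝ) × ℝ => w.1.2.2 * f w.1.1 w.1.2.1 (w.2 * w.1.2.2)) ?_ 0 1
  have : ContDiff ℝ k fun w : (ℝ × ℝ × ℝ) × ℝ => (w.1.1, w.1.2.1, w.2 * w.1.2.2) := by fun_prop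
  exact (by fun_prop : ContDiff ℝ k fun w : (ℝ × ℝ × ℝ) × ℝ => w.1.2.2).mul (hf.comp this)

theorem hasDerivAt_primitive {f : ℝ → ℝ → ℝ → ℝ}
    (hf : Continuous fun z : ℝ × ℝ × ℝ => f z.1 z.2.1 z.2.2) (t x u : ℝ) :
    HasDerivAt (fun u => primitive f t x u) (f t x u) u := by
  have hc : Continuous (f t x) :=
    hf.comp (by fun_prop : Continuous fun s : ℝ => ((t, x, s) : ℝ × ℝ × ℝ))
  exact intervalIntegral.integral_hasDerivAt_right (hc.intervalIntegrable _ _)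
    (hc.stronglyMeasurableAtFilter _ _) hc.continuousAt

@[simp] theorem primitive_zero (f : ℝ → ℝ → ℝ → ℝ) (t x : ℝ) : primitive f t x 0 = 0 := by
  simp [primitive]

/-- The chain rule along a curve. -/
theorem hasDerivAt_comp_curve {E : Type*} [NormedAddCommGroup E] [NormedSpace ℝ E] {F : E → ℝ}
    {γ : ℝ → E} {γ' : E} {s : ℝ} (hF : DifferentiableAt ℝ F (γ s)) (hγ : HasDerivAt γ γ' s) :
    HasDerivAt (fun r => F (γ r)) (fderiv ℝ F (γ s) γ') s :=
  hF.hasFDerivAt.comp_hasDerivAt s hγ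

/-! ### Partial derivatives of smooth fields -/

section Fields

variable {u : ℝ → ℝ → ℝ}

theorem SmoothField.differentiable (hu : SmoothField u) :
    Differentiable ℝ (fun p : ℝ × ℝ => u p.1 p.2) :=
  ContDiff.differentiable hu (by simp)

theorem SmoothField.dt_eq_fderiv (hu : SmoothField u) (t x : ℝ) :
    dt u t x = fderiv ℝ (fun p : ℝ × ℝ => u p.1 p.2) (t, x) (1, 0) := by
  have h : HasDerivAt (fun s => u s x) (fderiv ℝ (fun p : ℝ × ℝ => u p.1 p.2) (t, x) (1, 0)) t :=
    hasDerivAt_comp_curve (γ := fun s => (s, x)) (hu.differentiable (t, x))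
      ((hasDerivAt_id t).prodMk (hasDerivAt_const t x))
  exact h.deriv

theorem SmoothField.dx_eq_fderiv (hu : SmoothField u) (t x : ℝ) :
    dx u t x = fderiv ℝ (fun p : ℝ × ℝ => u p.1 p.2) (t, x) (0, 1) := by
  have h : HasDerivAt (fun y => u t y) (fderiv ℝ (fun p : ℝ × ℝ => u p.1 p.2) (t, x) (0, 1)) x :=
    hasDerivAt_comp_curve (γ := fun y => (t, y)) (hu.differentiable (t, x))
      ((hasDerivAt_const x t).prodMk (hasDerivAt_id x))
  exact h.deriv

theorem SmoothField.dt (hu : SmoothField u) : SmoothField (dt u) := by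
  have h : (fun p : ℝ × ℝ => DampedWave.dt u p.1 p.2)
      = fun p => fderiv ℝ (fun p : ℝ × ℝ => u p.1 p.2) p (1, 0) :=
    funext fun p => hu.dt_eq_fderiv p.1 p.2
  unfold SmoothField
  rw [h]
  exact (ContDiff.fderiv_right (m := ∞) hu (by simp)).clm_apply contDiff_const

theorem SmoothField.dx (hu : SmoothField u) : SmoothField (dx u) := by
  have h : (fun p : ℝ × ℝ => DampedWave.dx u p.1 p.2)
      = fun p => fderiv ℝ (fun p : ℝ × ℝ => u p.1 p.2) p (0, 1) :=
    funext fun p => hu.dx_eq_fderiv p.1 p.2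
  unfold SmoothField
  rw [h]
  exact (ContDiff.fderiv_right (m := ∞) hu (by simp)).clm_apply contDiff_const

theorem SmoothField.hasDerivAt_dt (hu : SmoothField u) (t x : ℝ) :
    HasDerivAt (fun s => u s x) (DampedWave.dt u t x) t := by
  rw [hu.dt_eq_fderiv]
  exact hasDerivAt_comp_curve (γ := fun s => (s, x)) (hu.differentiable (t, x))
    ((hasDerivAt_id t).prodMk (hasDerivAt_const t x))

theorem SmoothField.hasDerivAt_dx (hu : SmoothField u) (t x : ℝ) :
    HasDerivAt (fun y => u t y) (DampedWave.dx u t x) x := by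
  rw [hu.dx_eq_fderiv]
  exact hasDerivAt_comp_curve (γ := fun y => (t, y)) (hu.differentiable (t, x))
    ((hasDerivAt_const x t).prodMk (hasDerivAt_id x))

/-- Mixed partial derivatives of a smooth field commute. -/
theorem SmoothField.dt_dx (hu : SmoothField u) (t x : ℝ) :
    DampedWave.dt (DampedWave.dx u) t x = DampedWave.dx (DampedWave.dt u) t x := by
  set D := fderiv ℝ (fun p : ℝ × ℝ => u p.1 p.2) with hD
  have hd : DifferentiableAt ℝ D (t, x) :=
    (ContDiff.fderiv_right (m := ∞) hu (by simp)).differentiable (by simp) _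
  have hsymm := second_derivative_symmetric (fun p => (hu.differentiable p).hasFDerivAt)
    hd.hasFDerivAt (1, 0) (0, 1)
  have hv : ∀ w : ℝ × ℝ, HasFDerivAt (fun p => D p w) ((fderiv ℝ D (t, x)).flip w) (t, x) :=
    fun w => (hd.hasFDerivAt.clm_apply (hasFDerivAt_const w _)).congr_fderiv (by ext <;> simp)
  have h1 : HasDerivAt (fun s => DampedWave.dx u s x) (fderiv ℝ D (t, x) (1, 0) (0, 1)) t := by
    rw [funext fun s => hu.dx_eq_fderiv s x]
    exact (hv (0, 1)).comp_hasDerivAt t ((hasDerivAt_id t).prodMk (hasDerivAt_const t x))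
  have h2 : HasDerivAt (fun y => DampedWave.dt u t y) (fderiv ℝ D (t, x) (0, 1) (1, 0)) x := by
    rw [funext fun y => hu.dt_eq_fderiv t y]
    exact (hv (1, 0)).comp_hasDerivAt x ((hasDerivAt_const x t).prodMk (hasDerivAt_id x))
  exact h1.deriv.trans (hsymm.trans h2.deriv.symm)

end Fields

/-! ### The point transformation to the undamped equation -/

/-- The nonlinearity of the undamped equation for `v` obtained from
`u_tt + α u_t + f(t, x, u) = c² u_xx` by `u = e^{-(α/2) t} v`. -/
def undampedNonlinearity (α : ℝ) (f : ℝ → ℝ → ℝ → ℝ) (t x v : ℝ) : ℝ :=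
  Real.exp (α / 2 * t) * f t x (Real.exp (-(α / 2) * t) * v) - α ^ 2 / 4 * v

/-- The exponent `-α/2` is the one for which the term `-α v_t` coming from `u_tt` cancels the
damping; the leftover `α²/4 - α²/2` is the linear term of the new nonlinearity. -/
theorem waveExpr_exp_mul {α c : ℝ} {g : ℝ → ℝ → ℝ → ℝ → ℝ} {f : ℝ → ℝ → ℝ → ℝ}
    (hg : ∀ t x u p, g t x u p = α * p + f t x u) {v : ℝ → ℝ → ℝ} (hv : SmoothField v)
    (t x : ℝ) :
    waveExpr c g (fun t x => Real.exp (-(α / 2) * t) * v t x) t x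
      = Real.exp (-(α / 2) * t) * undampedExpr c (undampedNonlinearity α f) v t x := by
  have hE : ∀ t : ℝ, HasDerivAt (fun s : ℝ => Real.exp (-(α / 2) * s))
      (Real.exp (-(α / 2) * t) * (-(α / 2))) t := fun t => by
    simpa using ((hasDerivAt_id t).const_mul (-(α / 2))).exp
  have h1 : dt (fun t x => Real.exp (-(α / 2) * t) * v t x)
      = fun t x => Real.exp (-(α / 2) * t) * (-(α / 2)) * v t x
          + Real.exp (-(α / 2) * t) * dt v t x :=
    funext₂ fun t x => ((hE t).mul (hv.hasDerivAt_dt t x)).deriv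
  have h2 : dt (dt (fun t x => Real.exp (-(α / 2) * t) * v t x)) t x
      = Real.exp (-(α / 2) * t) * (dt (dt v) t x - α * dt v t x + α ^ 2 / 4 * v t x) := by
    rw [h1]
    refine ((((hE t).mul_const (-(α / 2))).mul (hv.hasDerivAt_dt t x)).add
      ((hE t).mul (hv.dt.hasDerivAt_dt t x))).deriv.trans ?_
    ring
  have h3 : dx (fun t x => Real.exp (-(α / 2) * t) * v t x)
      = fun t x => Real.exp (-(α / 2) * t) * dx v t x :=
    funext₂ fun t x => ((hv.hasDerivAt_dx t x).const_mul _).deriv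
  have h4 : dx (dx (fun t x => Real.exp (-(α / 2) * t) * v t x)) t x
      = Real.exp (-(α / 2) * t) * dx (dx v) t x := by
    rw [h3]
    exact ((hv.dx.hasDerivAt_dx t x).const_mul _).deriv
  have hexp : Real.exp (-(α / 2) * t) * Real.exp (α / 2 * t) = 1 := by
    rw [← Real.exp_add]; simp
  simp only [waveExpr, undampedExpr, undampedNonlinearity]
  rw [h2, h4, hg, h1]
  linear_combination (-f t x (Real.exp (-(α / 2) * t) * v t x)) * hexp

/-- The image equation is unique: at a given point, a field with `v = w`, `v_xx = 0` and `v_tt =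
-γ`, where `γ` is the computed nonlinearity, solves the transformed equation there, which forces `G
= γ`. -/
theorem mapsToUndamped_iff {α c : ℝ} {g : ℝ → ℝ → ℝ → ℝ → ℝ} {f : ℝ → ℝ → ℝ → ℝ}
    (hg : ∀ t x u p, g t x u p = α * p + f t x u) (G : ℝ → ℝ → ℝ → ℝ) :
    MapsToUndamped c α g G ↔ G = undampedNonlinearity α f := by
  constructor
  · intro h
    funext t x w
    set γ := undampedNonlinearity α f t x w
    let v : ℝ → ℝ → ℝ := fun s _ => w - γ / 2 * (s - t) ^ 2
    have hv : SmoothField v := by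
      change ContDiff ℝ ∞ fun p : ℝ × ℝ => w - γ / 2 * (p.1 - t) ^ 2
      fun_prop
    have hvt : dt v = fun s _ => -γ * (s - t) := by
      funext s y
      refine (((((hasDerivAt_id s).sub_const t).pow 2).const_mul (γ / 2)).const_sub w).deriv.trans ?_
      simp
      ring
    have hvtt : dt (dt v) t x = -γ := by
      rw [hvt]
      refine (((hasDerivAt_id t).sub_const t).const_mul (-γ)).deriv.trans (by simp)
    have hvx : dx v = fun _ _ => 0 := by
      funext s y
      exact deriv_const _ _
    have hvxx : dx (dx v) t x = 0 := by
      rw [hvx]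
      exact deriv_const _ _
    have hv0 : v t x = w := by simp [v]
    have key : ∀ H : ℝ → ℝ → ℝ → ℝ, undampedExpr c H v t x = -γ + H t x w := fun H => by
      simp only [undampedExpr, waveExpr, hvtt, hvxx, hv0]
      ring
    have h0 := (h v hv t x).1 (by rw [waveExpr_exp_mul hg hv, key]; simp [γ])
    rw [key] at h0
    linarith
  · rintro rfl v hv t x
    rw [waveExpr_exp_mul hg hv]
    simp [Real.exp_ne_zero]

/-! ### Symmetries of the undamped nonlinearity, finite and infinitesimal -/

/-- The one-parameter symmetry of an undamped nonlinearity which underlies a conservation law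
with multiplier `e^{A t + b x} (c₁ v_t + c₂ v_x)`. -/
def HasEnergyMomentumSymmetry (c : ℝ) (G : ℝ → ℝ → ℝ → ℝ) : Prop :=
  ∃ A b c₁ c₂ : ℝ, ¬ (c₁ = 0 ∧ c₂ = 0) ∧ A * c₁ = b * c₂ ∧ A * c₂ = c ^ 2 * b * c₁ ∧
    ∀ τ t x v : ℝ, G (t + c₁ * τ) (x + c₂ * τ) v = Real.exp (-(2 * b * c₂) * τ) * G t x v

/-- `G` is determined by its values on a line transversal to the flow: `x = 0` if `c₁ = 0`, and `t =
0` otherwise. For `b = 0` the factor is trivial and forms (i), (ii) result; `b ≠ 0` forces the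
characteristic directions `c₂ = ∓c c₁` and form (iii). -/
theorem energyMomentumForm_iff {c : ℝ} (hc : 0 < c) (G : ℝ → ℝ → ℝ → ℝ) :
    EnergyMomentumForm c G ↔ HasEnergyMomentumSymmetry c G := by
  constructor
  · rintro (⟨f, hf⟩ | ⟨c', f, hf⟩ | ⟨s, b, f, hs, hf⟩)
    · exact ⟨0, 0, 0, 1, by simp, by simp, by simp, fun τ t x v => by simp [hf]⟩
    · refine ⟨0, 0, 1, c', by simp, by simp, by simp, fun τ t x v => ?_⟩
      rw [hf, hf, show x + c' * τ - c' * (t + 1 * τ) = x - c' * t by ring]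
      simp
    · have hs2 : s ^ 2 = 1 := by rcases hs with rfl | rfl <;> norm_num
      refine ⟨-(s * c * b), b, 1, -(s * c), by simp, by ring, ?_, fun τ t x v => ?_⟩
      · linear_combination c ^ 2 * b * hs2
      · rw [hf, hf, ← mul_assoc, ← Real.exp_add,
          show x + -(s * c) * τ + s * c * (t + 1 * τ) = x + s * c * t by ring]
        congr 2
        ring
  · rintro ⟨A, b, c₁, c₂, hne, h1, h2, hG⟩
    by_cases hb : b = 0
    · subst hb
      by_cases hc1 : c₁ = 0
      · have hc2 : c₂ ≠ 0 := fun h => hne ⟨hc1, h⟩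
        refine Or.inl ⟨fun t v => G t 0 v, fun t x v => ?_⟩
        have := hG (x / c₂) t 0 v
        simpa [hc1, mul_div_cancel₀ _ hc2] using this
      · refine Or.inr (Or.inl ⟨c₂ / c₁, fun y v => G 0 y v, fun t x v => ?_⟩)
        have := hG (-t / c₁) t x v
        rw [show t + c₁ * (-t / c₁) = 0 by field_simp; ring,
          show x + c₂ * (-t / c₁) = x - c₂ / c₁ * t by ring] at this
        simpa using this.symm
    -- Elimination of `A` between the two relations.
    · have hsq : c₂ ^ 2 = (c * c₁) ^ 2 := mul_left_cancel₀ hb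
        (by linear_combination h2 * c₁ - h1 * c₂)
      have hc1 : c₁ ≠ 0 := by
        rintro rfl
        exact hne ⟨rfl, by simpa using hsq⟩
      obtain ⟨s, hs, hc2⟩ : ∃ s : ℝ, (s = 1 ∨ s = -1) ∧ c₂ = -(s * c * c₁) := by
        rcases sq_eq_sq_iff_eq_or_eq_neg.1 hsq with h | h
        · exact ⟨-1, Or.inr rfl, by rw [h]; ring⟩
        · exact ⟨1, Or.inl rfl, by rw [h]; ring⟩
      refine Or.inr (Or.inr ⟨s, b, fun y v => G 0 y v, hs, fun t x v => ?_⟩)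
      have := hG (-t / c₁) t x v
      rw [show t + c₁ * (-t / c₁) = 0 by field_simp; ring,
        show x + c₂ * (-t / c₁) = x + s * c * t by rw [hc2]; field_simp,
        show -(2 * b * c₂) * (-t / c₁) = -(2 * s * c * b * t) by rw [hc2]; field_simp] at this
      simp only [this]
      rw [← mul_assoc, ← Real.exp_add]
      simp

/-- The partial derivative of `W(t, x, u)` in `t`. -/
def partialT (W : ℝ → ℝ → ℝ → ℝ) (t x u : ℝ) : ℝ :=
  fderiv ℝ (fun z : ℝ × ℝ × ℝ => W z.1 z.2.1 z.2.2) (t, x, u) (1, 0, 0)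

/-- The partial derivative of `W(t, x, u)` in `x`. -/
def partialX (W : ℝ → ℝ → ℝ → ℝ) (t x u : ℝ) : ℝ :=
  fderiv ℝ (fun z : ℝ × ℝ × ℝ => W z.1 z.2.1 z.2.2) (t, x, u) (0, 1, 0)

/-- The partial derivative of `W(t, x, u)` in `u`. -/
def partialU (W : ℝ → ℝ → ℝ → ℝ) (t x u : ℝ) : ℝ :=
  fderiv ℝ (fun z : ℝ × ℝ × ℝ => W z.1 z.2.1 z.2.2) (t, x, u) (0, 0, 1)

/-- The chain rule for a function of `(t, x, u)`, in terms of its partial derivatives. -/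
theorem hasDerivAt_comp_three {W : ℝ → ℝ → ℝ → ℝ}
    (hW : Differentiable ℝ fun z : ℝ × ℝ × ℝ => W z.1 z.2.1 z.2.2) {τ ξ υ : ℝ → ℝ}
    {τ' ξ' υ' s : ℝ} (hτ : HasDerivAt τ τ' s) (hξ : HasDerivAt ξ ξ' s) (hυ : HasDerivAt υ υ' s) :
    HasDerivAt (fun r => W (τ r) (ξ r) (υ r))
      (partialT W (τ s) (ξ s) (υ s) * τ' + partialX W (τ s) (ξ s) (υ s) * ξ'
        + partialU W (τ s) (ξ s) (υ s) * υ') s := by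
  have h := hasDerivAt_comp_curve (γ := fun r => (τ r, ξ r, υ r)) (hW _)
    (hτ.prodMk (hξ.prodMk hυ))
  refine h.congr_deriv ?_
  have hsplit : ((τ', ξ', υ') : ℝ × ℝ × ℝ)
      = τ' • (1, 0, 0) + ξ' • (0, 1, 0) + υ' • (0, 0, 1) := by
    ext <;> simp
  rw [hsplit]
  simp only [map_add, map_smul, smul_eq_mul, partialT, partialX, partialU]
  ring

theorem partialU_primitive {f : ℝ → ℝ → ℝ → ℝ}
    (hf : ContDiff ℝ 1 fun z : ℝ × ℝ × ℝ => f z.1 z.2.1 z.2.2) (t x u : ℝ) :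
    partialU (primitive f) t x u = f t x u := by
  have h := hasDerivAt_comp_three
    ((contDiff_primitive (k := 1) hf).differentiable one_ne_zero)
    (hasDerivAt_const u t) (hasDerivAt_const u x) (hasDerivAt_id u)
  simpa using h.unique (hasDerivAt_primitive hf.continuous t x u)

/-- The potential of `undampedNonlinearity`: its primitive in `v` vanishing at `v = 0`. -/
def undampedPotential (α : ℝ) (f : ℝ → ℝ → ℝ → ℝ) (t x v : ℝ) : ℝ :=
  Real.exp (α * t) * primitive f t x (Real.exp (-(α / 2) * t) * v) - α ^ 2 / 8 * v ^ 2

theorem hasDerivAt_undampedPotential {f : ℝ → ℝ → ℝ → ℝ}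
    (hf : Continuous fun z : ℝ × ℝ × ℝ => f z.1 z.2.1 z.2.2) (α t x v : ℝ) :
    HasDerivAt (fun v => undampedPotential α f t x v) (undampedNonlinearity α f t x v) v := by
  have h1 : HasDerivAt (fun v => primitive f t x (Real.exp (-(α / 2) * t) * v))
      (f t x (Real.exp (-(α / 2) * t) * v) * (Real.exp (-(α / 2) * t) * 1)) v :=
    (hasDerivAt_primitive hf t x _).comp v ((hasDerivAt_id v).const_mul _)
  have h2 := (h1.const_mul (Real.exp (α * t))).sub
    (((hasDerivAt_id v).pow 2).const_mul (α ^ 2 / 8))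
  refine h2.congr_deriv ?_
  have he : Real.exp (α * t) * Real.exp (-(α / 2) * t) = Real.exp (α / 2 * t) := by
    rw [← Real.exp_add]; congr 1; ring
  simp only [undampedNonlinearity, ← he]
  simp
  ring

theorem eq_of_hasDerivAt_zero {h : ℝ → ℝ} (hh : ∀ s, HasDerivAt h 0 s) (s r : ℝ) : h s = h r :=
  is_const_of_deriv_eq_zero (fun s => (hh s).differentiableAt) (fun s => (hh s).deriv) s r

/-- The infinitesimal form of the symmetry of `undampedNonlinearity`, as a first-order linear
partial differential equation for the primitive of the original nonlinearity. -/
theorem symmetry_iff_pde {f : ℝ → ℝ → ℝ → ℝ}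
    (hf : ContDiff ℝ 1 fun z : ℝ × ℝ × ℝ => f z.1 z.2.1 z.2.2) (α b c₁ c₂ : ℝ) :
    (∀ τ t x v : ℝ, undampedNonlinearity α f (t + c₁ * τ) (x + c₂ * τ) v
        = Real.exp (-(2 * b * c₂) * τ) * undampedNonlinearity α f t x v) ↔
      ∀ t x u : ℝ, c₁ * partialT (primitive f) t x u + c₂ * partialX (primitive f) t x u
        - α * c₁ / 2 * u * f t x u + (2 * b * c₂ + α * c₁) * primitive f t x u
        - α ^ 2 / 4 * b * c₂ * u ^ 2 = 0 := by
  have hF : Differentiable ℝ fun z : ℝ × ℝ × ℝ => primitive f z.1 z.2.1 z.2.2 :=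
    (contDiff_primitive (k := 1) hf).differentiable one_ne_zero
  -- The symmetry is equivalent to `h` being constant in `τ`, and the `τ`-derivative of `h` is a
  -- positive factor times the PDE expression `P` at the transported point.
  set h : ℝ → ℝ → ℝ → ℝ → ℝ := fun t x v τ =>
    Real.exp (2 * b * c₂ * τ) * undampedPotential α f (t + c₁ * τ) (x + c₂ * τ) v with hh
  set P : ℝ → ℝ → ℝ → ℝ := fun t x u =>
    c₁ * partialT (primitive f) t x u + c₂ * partialX (primitive f) t x u
        - α * c₁ / 2 * u * f t x u + (2 * b * c₂ + α * c₁) * primitive f t x u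
        - α ^ 2 / 4 * b * c₂ * u ^ 2 with hP
  have hder : ∀ t x v τ, HasDerivAt (h t x v) (Real.exp (2 * b * c₂ * τ)
      * Real.exp (α * (t + c₁ * τ))
      * P (t + c₁ * τ) (x + c₂ * τ) (Real.exp (-(α / 2) * (t + c₁ * τ)) * v)) τ := by
    intro t x v τ
    have e1 : HasDerivAt (fun τ => 2 * b * c₂ * τ) (2 * b * c₂) τ := by
      simpa using (hasDerivAt_id τ).const_mul (2 * b * c₂)
    have et : HasDerivAt (fun τ => t + c₁ * τ) c₁ τ := by
      simpa using ((hasDerivAt_id τ).const_mul c₁).const_add t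
    have ex : HasDerivAt (fun τ => x + c₂ * τ) c₂ τ := by
      simpa using ((hasDerivAt_id τ).const_mul c₂).const_add x
    have h1 := e1.exp.mul ((((et.const_mul α).exp).mul (hasDerivAt_comp_three hF et ex
      (((et.const_mul (-(α / 2))).exp).mul_const v))).sub_const (α ^ 2 / 8 * v ^ 2))
    refine h1.congr_deriv ?_
    rw [partialU_primitive hf]
    have he : Real.exp (α * (t + c₁ * τ)) * Real.exp (-(α / 2) * (t + c₁ * τ)) ^ 2 = 1 := by
      rw [← Real.exp_nat_mul, ← Real.exp_add, Real.exp_eq_one_iff]; push_cast; ring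
    simp only [hP, Pi.mul_apply]
    linear_combination (Real.exp (2 * b * c₂ * τ) * (α ^ 2 / 4 * b * c₂ * v ^ 2)) * he
  have hexp : ∀ τ, Real.exp (2 * b * c₂ * τ) * Real.exp (-(2 * b * c₂) * τ) = 1 := fun τ => by
    rw [← Real.exp_add]; simp
  constructor
  · intro hs t x u
    -- Both sides have the same `v`-derivative by the symmetry, and both potentials vanish at `v =
    -- 0`.
    have hconst : ∀ v τ, h t x v τ = h t x v 0 := by
      intro v τ
      have h0 : ∀ v, HasDerivAt (fun v => h t x v τ - h t x v 0) 0 v := fun v => by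
        refine (((hasDerivAt_undampedPotential hf.continuous α _ _ v).const_mul _).sub
          ((hasDerivAt_undampedPotential hf.continuous α _ _ v).const_mul _)).congr_deriv ?_
        rw [hs, hs, ← mul_assoc, hexp]
        simp
      have := eq_of_hasDerivAt_zero h0 v 0
      simp only [hh, undampedPotential] at this ⊢
      simp at this ⊢
      linarith
    -- The value `v = e^{αt/2} u` makes the last argument of `P` equal to `u` at `τ = 0`.
    have h1 := hder t x (Real.exp (α / 2 * t) * u) 0
    rw [funext (hconst _)] at h1
    have h2 := h1.unique (hasDerivAt_const _ _)
    have he : Real.exp (-(α / 2 * t)) * (Real.exp (α / 2 * t) * u) = u := by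
      rw [← mul_assoc, ← Real.exp_add]; simp
    simpa [he, Real.exp_ne_zero] using h2
  · intro hp τ t x v
    have hconst : ∀ v, h t x v τ = h t x v 0 := fun v =>
      eq_of_hasDerivAt_zero (fun s => (hder t x v s).congr_deriv (by rw [hP]; simp [hp])) τ 0
    have h1 := (hasDerivAt_undampedPotential hf.continuous α (t + c₁ * τ) (x + c₂ * τ) v).const_mul
      (Real.exp (2 * b * c₂ * τ))
    have h2 := hasDerivAt_undampedPotential hf.continuous α t x v
    have h3 : (fun v => Real.exp (2 * b * c₂ * τ)
        * undampedPotential α f (t + c₁ * τ) (x + c₂ * τ) v)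
        = fun v => undampedPotential α f t x v := by
      funext v
      simpa [hh] using hconst v
    rw [h3] at h1
    rw [← h1.unique h2]
    linear_combination (-undampedNonlinearity α f (t + c₁ * τ) (x + c₂ * τ) v) * hexp τ

/-! ### Sufficiency: construction of the conservation law -/

/-- A symmetry of the undamped nonlinearity yields an energy-momentum type conservation law of
the damped equation. -/
theorem hasEnergyMomentumLaw_of_symmetry {k : ℕ∞} (hk : 1 ≤ k) {c α : ℝ}
    {g : ℝ → ℝ → ℝ → ℝ → ℝ} {f : ℝ → ℝ → ℝ → ℝ}
    (hf : ContDiff ℝ k fun z : ℝ × ℝ × ℝ => f z.1 z.2.1 z.2.2)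
    (hg : ∀ t x u p, g t x u p = α * p + f t x u)
    (hsym : HasEnergyMomentumSymmetry c (undampedNonlinearity α f)) :
    HasEnergyMomentumLaw k c g := by
  obtain ⟨A, b, c₁, c₂, hne, hA₁, hA₂, hs⟩ := hsym
  have hf1 : ContDiff ℝ 1 fun z : ℝ × ℝ × ℝ => f z.1 z.2.1 z.2.2 :=
    hf.of_le (by exact_mod_cast hk)
  have hpde := (symmetry_iff_pde hf1 α b c₁ c₂).1 hs
  have hFk := contDiff_primitive hf
  have hF : Differentiable ℝ fun z : ℝ × ℝ × ℝ => primitive f z.1 z.2.1 z.2.2 :=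
    (contDiff_primitive (k := 1) hf1).differentiable one_ne_zero
  -- This is the law with density `e^{At+bx}(½c₁(v_t² + c² v_x²) + c₂ v_x v_t + c₁W)`, `W` the
  -- potential of the `v`-equation, written in `u`: `v_t = e^{αt/2}(u_t + αu/2)`, and the squared
  -- exponential shifts `A` to `A + α`. The `u²` term of `½c₁ v_t²` cancels that of `c₁W`, hence its
  -- absence from `C`.
  refine ⟨A + α, b, α * c₁ / 2, c₁, c₂,
    fun t x u q => Real.exp ((A + α) * t + b * x)
      * (α / 2 * c₂ * u * q + 1 / 2 * c₁ * c ^ 2 * q ^ 2 + c₁ * primitive f t x u), 1,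
    fun t x y z => Real.exp ((A + α) * t + b * x)
      * (-(1 / 2) * c₂ * (z 0 + α / 2 * y 0) ^ 2 - c ^ 2 * c₁ * (z 0 + α / 2 * y 0) * y 1
        - 1 / 2 * c ^ 2 * c₂ * y 1 ^ 2 + c₂ * (primitive f t x (y 0) - α ^ 2 / 8 * y 0 ^ 2)),
    ?_, ?_, ?_, ?_⟩
  · rintro ⟨-, h1, h2⟩
    exact hne ⟨h1, h2⟩
  · have hFc : ContDiff ℝ k fun z : ℝ × ℝ × ℝ × ℝ => primitive f z.1 z.2.1 z.2.2.1 :=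
      hFk.comp (by fun_prop : ContDiff ℝ k fun z : ℝ × ℝ × ℝ × ℝ => (z.1, z.2.1, z.2.2.1))
    fun_prop
  · have hFc : ContDiff ℝ k fun z : ℝ × ℝ × (Fin (1 + 1) → ℝ) × (Fin (1 + 1) → ℝ) =>
        primitive f z.1 z.2.1 (z.2.2.1 0) :=
      hFk.comp (by fun_prop : ContDiff ℝ k
        fun z : ℝ × ℝ × (Fin (1 + 1) → ℝ) × (Fin (1 + 1) → ℝ) => (z.1, z.2.1, z.2.2.1 0))
    fun_prop
  · intro u hu t x
    have hφt : HasDerivAt (fun s => Real.exp ((A + α) * s + b * x))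
        (Real.exp ((A + α) * t + b * x) * (A + α)) t := by
      simpa using (((hasDerivAt_id t).const_mul (A + α)).add_const (b * x)).exp
    have hφx : HasDerivAt (fun y => Real.exp ((A + α) * t + b * y))
        (Real.exp ((A + α) * t + b * x) * b) x := by
      simpa using (((hasDerivAt_id x).const_mul b).const_add ((A + α) * t)).exp
    have ut := hu.hasDerivAt_dt t x
    have ux := hu.hasDerivAt_dx t x
    have utt := hu.dt.hasDerivAt_dt t x
    have utx := hu.dt.hasDerivAt_dx t x
    have uxt := hu.dx.hasDerivAt_dt t x
    have uxx := hu.dx.hasDerivAt_dx t x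
    have Ft := hasDerivAt_comp_three hF (hasDerivAt_id t) (hasDerivAt_const t x) ut
    have Fx := hasDerivAt_comp_three hF (hasDerivAt_const x t) (hasDerivAt_id x) ux
    have hT := (hφt.mul ((((utt.pow 2).const_mul (1 / 2 * c₁)).add
        ((uxt.const_mul c₂).mul utt)).add ((ut.const_mul (α * c₁ / 2)).mul utt))).add
      (hφt.mul ((((ut.const_mul (α / 2 * c₂)).mul uxt).add
        ((uxt.pow 2).const_mul (1 / 2 * c₁ * c ^ 2))).add (Ft.const_mul c₁)))
    have hw := utx.add (ux.const_mul (α / 2))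
    have hΨ := hφx.mul (((((hw.pow 2).const_mul (-(1 / 2) * c₂)).sub
        ((hw.const_mul (c ^ 2 * c₁)).mul uxx)).sub
        ((uxx.pow 2).const_mul (1 / 2 * c ^ 2 * c₂))).add
        ((Fx.sub ((ux.pow 2).const_mul (α ^ 2 / 8))).const_mul c₂))
    have eT := hT.deriv
    have eΨ := hΨ.deriv
    have hp := hpde t x (u t x)
    have hcomm := hu.dt_dx t x
    rw [waveExpr, multiplier, hg]
    refine Eq.trans ?_ (congrArg₂ (· + ·) eT eΨ).symm
    simp only [partialU_primitive hf1, id, Pi.add_apply, Pi.mul_apply, Pi.pow_apply, Pi.sub_apply]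
    rw [hcomm]
    -- The factors of `hA₁` and `hA₂` are, up to the common exponential, the energy density of `v`
    -- and `v_t v_x`.
    linear_combination (-Real.exp ((A + α) * t + b * x)) * (hp
      + (1 / 2 * (dt u t x + α / 2 * u t x) ^ 2 + 1 / 2 * c ^ 2 * dx u t x ^ 2
        + primitive f t x (u t x) - α ^ 2 / 8 * u t x ^ 2) * hA₁
      + (dt u t x + α / 2 * u t x) * dx u t x * hA₂)

/-! ### Test fields with polynomial Cauchy data, and their jets -/

open Polynomial in
/-- The field `P(y - x₀) + (s - t₀) Q(y - x₀)`, whose Cauchy data at time `t₀` are polynomial. -/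
def polynomialField (t₀ x₀ : ℝ) (P Q : ℝ[X]) (s y : ℝ) : ℝ :=
  P.eval (y - x₀) + (s - t₀) * Q.eval (y - x₀)

section PolynomialField

open Polynomial

variable (t₀ x₀ : ℝ) (P Q : ℝ[X])

theorem smoothField_polynomialField : SmoothField (polynomialField t₀ x₀ P Q) := by
  have h : ∀ R : ℝ[X], ContDiff ℝ ∞ fun p : ℝ × ℝ => R.eval (p.2 - x₀) := fun R =>
    (by simpa using R.contDiff_aeval (𝕜 := ℝ) ∞ : ContDiff ℝ ∞ fun y : ℝ => R.eval y).comp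
      (by fun_prop : ContDiff ℝ ∞ fun p : ℝ × ℝ => p.2 - x₀)
  exact (h P).add ((by fun_prop : ContDiff ℝ ∞ fun p : ℝ × ℝ => p.1 - t₀).mul (h Q))

theorem hasDerivAt_eval_sub (R : ℝ[X]) (y : ℝ) :
    HasDerivAt (fun y => R.eval (y - x₀)) (R.derivative.eval (y - x₀)) y := by
  have h : HasDerivAt (fun y => y - x₀) 1 y := (hasDerivAt_id y).sub_const x₀
  exact ((R.hasDerivAt (y - x₀)).comp y h).congr_deriv (mul_one _)

theorem dt_polynomialField :
    dt (polynomialField t₀ x₀ P Q) = polynomialField t₀ x₀ Q 0 := by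
  funext s y
  have h : HasDerivAt (fun s => polynomialField t₀ x₀ P Q s y) (Q.eval (y - x₀)) s := by
    simpa [polynomialField] using
      (((hasDerivAt_id s).sub_const t₀).mul_const (Q.eval (y - x₀))).const_add (P.eval (y - x₀))
  exact h.deriv.trans (by simp [polynomialField])

theorem dx_polynomialField :
    dx (polynomialField t₀ x₀ P Q) = polynomialField t₀ x₀ (derivative P) (derivative Q) :=
  funext₂ fun s y => ((hasDerivAt_eval_sub x₀ P y).add
    ((hasDerivAt_eval_sub x₀ Q y).const_mul (s - t₀))).deriv

theorem iterate_dx_polynomialField (i : ℕ) :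
    dx^[i] (polynomialField t₀ x₀ P Q)
      = polynomialField t₀ x₀ (derivative^[i] P) (derivative^[i] Q) := by
  induction i with
  | zero => rfl
  | succ i ih => simp only [Function.iterate_succ_apply', ih, dx_polynomialField]

/-- The jet of order `N` at the origin of a polynomial. -/
def jet (N : ℕ) (P : ℝ[X]) : Fin (N + 1) → ℝ := fun i => (derivative^[(i : ℕ)] P).eval 0

theorem jet_add (N : ℕ) : jet N (P + Q) = jet N P + jet N Q := by
  funext i
  simp [jet, iterate_map_add]

theorem jet_C_mul (N : ℕ) (r : ℝ) : jet N (C r * P) = r • jet N P := by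
  funext i
  simp [jet, iterate_derivative_C_mul]

theorem jet_zero (N : ℕ) : jet N 0 = 0 := by
  funext i
  simp [jet]

theorem jet_X_pow_of_lt {N n : ℕ} (h : N < n) : jet N (X ^ n : ℝ[X]) = 0 := by
  funext i
  have : n - (i : ℕ) ≠ 0 := by omega
  simp [jet, iterate_derivative_X_pow_eq_smul, this]

/-- The Taylor polynomial realises any prescribed jet, so identities along polynomial fields hold on
the whole jet space. -/
theorem jet_surjective (N : ℕ) : Function.Surjective (jet N) := by
  intro y
  refine ⟨∑ j : Fin (N + 1), C (y j / (Nat.factorial j : ℝ)) * X ^ (j : ℕ), ?_⟩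
  funext i
  have hi : (Nat.factorial i : ℝ) ≠ 0 := by exact_mod_cast Nat.factorial_ne_zero _
  simp only [jet]
  rw [← coeff_zero_eq_eval_zero, coeff_iterate_derivative, zero_add, Nat.descFactorial_self,
    finsetSum_coeff, Finset.sum_eq_single i]
  · simp only [coeff_C_mul_X_pow, if_true, nsmul_eq_mul]
    field_simp
  · intro j _ hj
    have : (i : ℕ) ≠ j := fun h => hj (Fin.ext h.symm)
    simp [this]
  · simp

theorem hasDerivAt_jet_curve (N : ℕ) :
    HasDerivAt (fun y => fun i : Fin (N + 1) => (derivative^[(i : ℕ)] P).eval (y - x₀))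
      (jet N (derivative P)) x₀ := by
  refine hasDerivAt_pi.2 fun i => ?_
  refine (hasDerivAt_eval_sub x₀ _ x₀).congr_deriv ?_
  simp only [jet, sub_self, ← Function.iterate_succ_apply]
  rw [Function.iterate_succ_apply']

end PolynomialField

/-! ### Reduction of the flux to low order -/

section JetReduction

open Polynomial

variable {N : ℕ} {F : ℝ × ℝ × (Fin (N + 1) → ℝ) × (Fin (N + 1) → ℝ) → ℝ}

/-- `F` does not change when the jets are translated along those of `V` and `W`. -/
def JetInvariant (F : ℝ × ℝ × (Fin (N + 1) → ℝ) × (Fin (N + 1) → ℝ) → ℝ) (V W : ℝ[X]) : Prop :=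
  ∀ (t x r : ℝ) (y z : Fin (N + 1) → ℝ), F (t, x, y + r • jet N V, z + r • jet N W) = F (t, x, y, z)

theorem JetInvariant.of_C_mul {V W : ℝ[X]} {r : ℝ} (hr : r ≠ 0)
    (h : JetInvariant F (C r * V) (C r * W)) : JetInvariant F V W := by
  intro t x s y z
  have := h t x (s / r) y z
  simpa [jet_C_mul, smul_smul, div_mul_cancel₀ _ hr] using this

theorem JetInvariant.C_mul {V W : ℝ[X]} (h : JetInvariant F V W) (r : ℝ) :
    JetInvariant F (C r * V) (C r * W) := by
  intro t x s y z
  simpa [jet_C_mul, smul_smul] using h t x (s * r) y z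

theorem JetInvariant.fderiv_eq {V W : ℝ[X]} (h : JetInvariant F V W) (t x : ℝ) (P Q : ℝ[X]) :
    fderiv ℝ F (t, x, jet N (P + V), jet N (Q + W)) = fderiv ℝ F (t, x, jet N P, jet N Q) := by
  have h1 : (fun z => F (z + (0, 0, jet N V, jet N W))) = F := by
    funext ⟨t, x, y, z⟩
    simpa using h t x 1 y z
  have h2 := fderiv_comp_add_right (𝕜 := ℝ) (f := F) (x := (t, x, jet N P, jet N Q))
    (0, 0, jet N V, jet N W)
  rw [h1] at h2
  rw [h2, jet_add, jet_add]
  simp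

/-- If the total `x`-derivative of `F` does not notice a translation along which `F` is invariant,
then `F` is also invariant along the derivative of that translation. -/
theorem JetInvariant.derivative (hF : Differentiable ℝ F) {R : ℝ → ℝ → ℝ[X] → ℝ[X] → ℝ}
    (hR : ∀ t x P Q, fderiv ℝ F (t, x, jet N P, jet N Q)
      (0, 1, jet N (derivative P), jet N (derivative Q)) = R t x P Q)
    {V W : ℝ[X]} (h : JetInvariant F V W) (hVW : ∀ t x P Q, R t x (P + V) (Q + W) = R t x P Q) :
    JetInvariant F (Polynomial.derivative V) (Polynomial.derivative W) := by
  have hzero : ∀ t x y z, fderiv ℝ F (t, x, y, z)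
      (0, 0, jet N (Polynomial.derivative V), jet N (Polynomial.derivative W)) = 0 := by
    intro t x y z
    obtain ⟨P, rfl⟩ := jet_surjective N y
    obtain ⟨Q, rfl⟩ := jet_surjective N z
    have h1 := hR t x (P + V) (Q + W)
    -- The translation leaves the differential of `F` unchanged and shifts only the direction in
    -- which it is evaluated, by the jets of `V'` and `W'`.
    rw [hVW, ← hR, h.fderiv_eq, ← sub_eq_zero, ← map_sub] at h1
    simpa [jet_add] using h1
  intro t x r y z
  set γ : ℝ → ℝ × ℝ × (Fin (N + 1) → ℝ) × (Fin (N + 1) → ℝ) := fun r =>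
    (t, x, y + r • jet N (Polynomial.derivative V), z + r • jet N (Polynomial.derivative W)) with hγ
  have hd : ∀ r, HasDerivAt (fun r => F (γ r)) 0 r := by
    intro r
    have hγ' : HasDerivAt γ
        (0, 0, jet N (Polynomial.derivative V), jet N (Polynomial.derivative W)) r := by
      refine (hasDerivAt_const r t).prodMk ((hasDerivAt_const r x).prodMk (.prodMk ?_ ?_))
      · simpa using ((hasDerivAt_id r).smul_const (jet N (Polynomial.derivative V))).const_add y
      · simpa using ((hasDerivAt_id r).smul_const (jet N (Polynomial.derivative W))).const_add z
    exact (hasDerivAt_comp_curve (hF _) hγ').congr_deriv (hzero _ _ _ _)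
  simpa [hγ] using eq_of_hasDerivAt_zero hd r 0

/-- A flux whose total `x`-derivative depends only on `t`, `x`, `u`, `u_x`, `u_xx`, `p`, `p_x` does
not depend on the jets beyond `u`, `u_x` and `p`. -/
theorem jetInvariant_of_low_order (hF : Differentiable ℝ F)
    {R : ℝ → ℝ → ℝ → ℝ → ℝ → ℝ → ℝ → ℝ}
    (hR : ∀ t x P Q, fderiv ℝ F (t, x, jet N P, jet N Q)
      (0, 1, jet N (derivative P), jet N (derivative Q))
        = R t x (P.eval 0) ((derivative P).eval 0) ((derivative (derivative P)).eval 0)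
          (Q.eval 0) ((derivative Q).eval 0)) :
    JetInvariant F (X ^ 2) 0 ∧ JetInvariant F 0 X := by
  constructor
  -- Descent in the degree: `X^(N+2)` has zero `N`-jet, and as `R` sees `P` only up to its second
  -- derivative, `X^(n+3)` goes unnoticed and invariance passes to `X^(n+2)`. The descent stops at
  -- `X²`, which changes `u_xx`.
  · have key : ∀ m : ℕ, m ≤ N → JetInvariant F (X ^ (N - m + 2)) 0 := by
      intro m
      induction m with
      | zero =>
        intro _ t x r y z
        simp [jet_zero, jet_X_pow_of_lt (show N < N + 2 by omega)]
      | succ m ih =>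
        intro hm
        obtain ⟨n, hn⟩ : ∃ n, n = N - (m + 1) := ⟨_, rfl⟩
        have h1 := (ih (by omega)).derivative hF hR (fun t x P Q => by
          rw [show N - m + 2 = n + 3 by omega]
          simp)
        rw [show N - m + 2 = n + 3 by omega] at h1
        rw [← hn]
        refine JetInvariant.of_C_mul (r := (n + 3 : ℕ)) (by positivity) ?_
        rwa [derivative_X_pow, derivative_zero, ← mul_zero (C _)] at h1
    simpa using key N le_rfl
  -- `R` sees `Q` only up to its first derivative, so here the descent reaches `X`.
  · have key : ∀ m : ℕ, m ≤ N → JetInvariant F 0 (X ^ (N - m + 1)) := by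
      intro m
      induction m with
      | zero =>
        intro _ t x r y z
        simp [jet_zero, jet_X_pow_of_lt (show N < N + 1 by omega)]
      | succ m ih =>
        intro hm
        obtain ⟨n, hn⟩ : ∃ n, n = N - (m + 1) := ⟨_, rfl⟩
        have h1 := (ih (by omega)).derivative hF hR (fun t x P Q => by
          rw [show N - m + 1 = n + 2 by omega]
          simp)
        rw [show N - m + 1 = n + 2 by omega] at h1
        rw [← hn]
        refine JetInvariant.of_C_mul (r := (n + 2 : ℕ)) (by positivity) ?_
        rwa [derivative_X_pow, derivative_zero, ← mul_zero (C _)] at h1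
    simpa using key N le_rfl

end JetReduction

/-- The pointwise determining equation of an energy-momentum type conservation law: the flux may
be taken to depend on `t`, `x`, `u`, `q = u_x`, `p = u_t` only, and the identity becomes one in
independent variables `t`, `x`, `u`, `q`, `r = u_xx`, `p`, `s = u_tx`. -/
theorem exists_low_order_flux {k : ℕ∞} (hk : 1 ≤ k) {a b c c₀ c₁ c₂ : ℝ}
    {g C : ℝ → ℝ → ℝ → ℝ → ℝ} {N : ℕ}
    {Ψ : ℝ → ℝ → (Fin (N + 1) → ℝ) → (Fin (N + 1) → ℝ) → ℝ}
    (hC : ContDiff ℝ k (fun z : ℝ × ℝ × ℝ × ℝ => C z.1 z.2.1 z.2.2.1 z.2.2.2))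
    (hΨ : ContDiff ℝ k (fun z : ℝ × ℝ × (Fin (N + 1) → ℝ) × (Fin (N + 1) → ℝ) =>
      Ψ z.1 z.2.1 z.2.2.1 z.2.2.2))
    (h : ∀ u : ℝ → ℝ → ℝ, SmoothField u → ∀ t x : ℝ,
      waveExpr c g u t x * multiplier a b c₀ c₁ c₂ u t x
        = dt (density a b c₀ c₁ c₂ C u) t x + dx (flux Ψ u) t x) :
    ∃ Φ : ℝ × ℝ × ℝ × ℝ × ℝ → ℝ, ContDiff ℝ 1 Φ ∧ ∀ t x u q r p s : ℝ,
      (-c ^ 2 * r + g t x u p) * (Real.exp (a * t + b * x) * (c₁ * p + c₂ * q + c₀ * u))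
        = Real.exp (a * t + b * x) * (a * (1 / 2 * c₁ * p ^ 2 + c₂ * q * p + c₀ * u * p)
            + c₂ * s * p + c₀ * p ^ 2)
          + fderiv ℝ (fun z : ℝ × ℝ × ℝ × ℝ => C z.1 z.2.1 z.2.2.1 z.2.2.2) (t, x, u, q)
              (1, 0, p, s)
          + fderiv ℝ Φ (t, x, u, q, p) (0, 1, q, r, s) := by
  have hk0 : (k : WithTop ℕ∞) ≠ 0 := by
    rintro h0
    have : k = 0 := by exact_mod_cast h0
    simp [this] at hk
  have hCd := hC.differentiable hk0
  have hΨd := hΨ.differentiable hk0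
  set Cf : ℝ × ℝ × ℝ × ℝ → ℝ := fun z => C z.1 z.2.1 z.2.2.1 z.2.2.2 with hCf
  set Ψf : ℝ × ℝ × (Fin (N + 1) → ℝ) × (Fin (N + 1) → ℝ) → ℝ :=
    fun z => Ψ z.1 z.2.1 z.2.2.1 z.2.2.2 with hΨf
  set R : ℝ → ℝ → ℝ → ℝ → ℝ → ℝ → ℝ → ℝ := fun t x u q r p s =>
    (-c ^ 2 * r + g t x u p) * (Real.exp (a * t + b * x) * (c₁ * p + c₂ * q + c₀ * u))
      - (Real.exp (a * t + b * x) * (a * (1 / 2 * c₁ * p ^ 2 + c₂ * q * p + c₀ * u * p)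
            + c₂ * s * p + c₀ * p ^ 2) + fderiv ℝ Cf (t, x, u, q) (1, 0, p, s)) with hR
  have hjet : ∀ t x (P Q : Polynomial ℝ), fderiv ℝ Ψf (t, x, jet N P, jet N Q)
      (0, 1, jet N (Polynomial.derivative P), jet N (Polynomial.derivative Q))
        = R t x (P.eval 0) ((Polynomial.derivative P).eval 0)
          ((Polynomial.derivative (Polynomial.derivative P)).eval 0)
          (Q.eval 0) ((Polynomial.derivative Q).eval 0) := by
    intro t x P Q
    -- This field has `u_tt = 0`. Nothing is lost, since the terms in `u_tt` agree identically by `Q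
    -- = ∂T/∂u_t`.
    have h0 := h (polynomialField t x P Q) (smoothField_polynomialField t x P Q) t x
    have e0 : HasDerivAt (fun s => Real.exp (a * s + b * x))
        (Real.exp (a * t + b * x) * a) t := by
      simpa using (((hasDerivAt_id t).const_mul a).add_const (b * x)).exp
    have hlin : ∀ y z : ℝ, HasDerivAt (fun s => y + (s - t) * z) z t := fun y z => by
      simpa using (((hasDerivAt_id t).sub_const t).mul_const z).const_add y
    have eu := hlin (P.eval 0) (Q.eval 0)
    have eq := hlin ((Polynomial.derivative P).eval 0) ((Polynomial.derivative Q).eval 0)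
    have eC := hasDerivAt_comp_curve (F := Cf)
      (γ := fun s => (s, x, P.eval 0 + (s - t) * Q.eval 0,
        (Polynomial.derivative P).eval 0 + (s - t) * (Polynomial.derivative Q).eval 0)) (hCd _)
      ((hasDerivAt_id t).prodMk ((hasDerivAt_const t x).prodMk (eu.prodMk eq)))
    have e1 := (e0.mul ((((eq.const_mul c₂).mul_const (Q.eval 0)).const_add
      (1 / 2 * c₁ * Q.eval 0 ^ 2)).add ((eu.const_mul c₀).mul_const (Q.eval 0)))).add eC
    have e2 := hasDerivAt_comp_curve (F := Ψf)
      (γ := fun y => (t, y, (fun i : Fin (N + 1) => (Polynomial.derivative^[(i : ℕ)] P).eval (y - x)),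
        fun i : Fin (N + 1) => (Polynomial.derivative^[(i : ℕ)] Q).eval (y - x))) (hΨd _)
      ((hasDerivAt_const x t).prodMk ((hasDerivAt_id x).prodMk
        ((hasDerivAt_jet_curve x P N).prodMk (hasDerivAt_jet_curve x Q N))))
    have eT : dt (density a b c₀ c₁ c₂ C (polynomialField t x P Q)) t x
        = Real.exp (a * t + b * x) * (a * (1 / 2 * c₁ * Q.eval 0 ^ 2
            + c₂ * (Polynomial.derivative P).eval 0 * Q.eval 0 + c₀ * P.eval 0 * Q.eval 0)
            + c₂ * (Polynomial.derivative Q).eval 0 * Q.eval 0 + c₀ * Q.eval 0 ^ 2)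
          + fderiv ℝ Cf (t, x, P.eval 0, (Polynomial.derivative P).eval 0)
              (1, 0, Q.eval 0, (Polynomial.derivative Q).eval 0) := by
      refine Eq.trans (congrArg (fun f => deriv f t) ?_) (e1.deriv.trans ?_)
      · funext s
        simp [density, dt_polynomialField, dx_polynomialField, polynomialField, hCf]
      · simp
        ring
    have eX : dx (flux Ψ (polynomialField t x P Q)) t x
        = fderiv ℝ Ψf (t, x, jet N P, jet N Q)
          (0, 1, jet N (Polynomial.derivative P), jet N (Polynomial.derivative Q)) := by
      refine Eq.trans (congrArg (fun f => deriv f x) ?_) (e2.deriv.trans ?_)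
      · funext y
        simp [flux, dt_polynomialField, iterate_dx_polynomialField, polynomialField, hΨf]
      · simp only [sub_self]
        rfl
    rw [eT, eX] at h0
    simp only [waveExpr, multiplier, dt_polynomialField, dx_polynomialField] at h0
    simp only [polynomialField, sub_self, zero_mul, add_zero, Polynomial.eval_zero] at h0
    simp only [hR]
    linear_combination -h0
  obtain ⟨hP2, hQ1⟩ := jetInvariant_of_low_order hΨd hjet
  set e₀ := jet N (1 : Polynomial ℝ) with he₀
  set e₁ := jet N (Polynomial.X : Polynomial ℝ) with he₁
  set L : ℝ × ℝ × ℝ × ℝ × ℝ → ℝ × ℝ × (Fin (N + 1) → ℝ) × (Fin (N + 1) → ℝ) := fun z =>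
    (z.1, z.2.1, z.2.2.1 • e₀ + z.2.2.2.1 • e₁, z.2.2.2.2 • e₀) with hL
  have hLc : ContDiff ℝ k L := by fun_prop
  refine ⟨Ψf ∘ L, (hΨ.comp hLc).of_le (by exact_mod_cast hk), fun t x u q r p s => ?_⟩
  have hchain : fderiv ℝ (Ψf ∘ L) (t, x, u, q, p) (0, 1, q, r, s)
      = fderiv ℝ Ψf (L (t, x, u, q, p)) (0, 1, q • e₀ + r • e₁, s • e₀) := by
    have hγ : HasDerivAt (fun y : ℝ => ((t, x, u, q, p) : ℝ × ℝ × ℝ × ℝ × ℝ) + y • (0, 1, q, r, s))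
        (0, 1, q, r, s) 0 := by
      simpa using ((hasDerivAt_id (0 : ℝ)).smul_const
        ((0, 1, q, r, s) : ℝ × ℝ × ℝ × ℝ × ℝ)).const_add (t, x, u, q, p)
    have hLγ : HasDerivAt
        (fun y : ℝ => L (((t, x, u, q, p) : ℝ × ℝ × ℝ × ℝ × ℝ) + y • (0, 1, q, r, s)))
        (0, 1, q • e₀ + r • e₁, s • e₀) 0 := by
      have hlin : ∀ y z : ℝ, HasDerivAt (fun τ : ℝ => y + τ * z) z 0 := fun y z => by
        simpa using ((hasDerivAt_id (0 : ℝ)).mul_const z).const_add y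
      simp only [hL, Prod.smul_mk, Prod.mk_add_mk, smul_eq_mul]
      exact (by simpa using hlin t 0 : HasDerivAt (fun τ : ℝ => t + τ * 0) 0 0).prodMk
        ((hlin x 1).prodMk ((((hlin u q).smul_const e₀).add ((hlin q r).smul_const e₁)).prodMk
          ((hlin p s).smul_const e₀)))
    have h1 := hasDerivAt_comp_curve (F := Ψf ∘ L)
      (((hΨ.comp hLc).differentiable hk0) _) hγ
    have h2 := hasDerivAt_comp_curve (F := Ψf) (hΨd _) hLγ
    simpa using h1.unique h2
  rw [hchain]
  set P : Polynomial ℝ := Polynomial.C u * 1 + Polynomial.C q * Polynomial.X with hP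
  set Q : Polynomial ℝ := Polynomial.C p * 1 with hQ
  have hJP : jet N P = u • e₀ + q • e₁ := by rw [hP, jet_add, jet_C_mul, jet_C_mul]
  have hJQ : jet N Q = p • e₀ := by rw [hQ, jet_C_mul]
  -- The polynomials `u + qX + (r/2)X²` and `p + sX` carry the required `u_xx` and `u_tx`.
  -- Invariance removes their top terms from the base point, while the derivatives of these terms
  -- still contribute `r` and `s` to the direction.
  have hV := (hP2.C_mul (r / 2)).fderiv_eq t x P (Q + Polynomial.C s * Polynomial.X)
  have hW := (hQ1.C_mul s).fderiv_eq t x P Q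
  simp only [mul_zero, add_zero] at hV hW
  have h1 := hjet t x (P + Polynomial.C (r / 2) * Polynomial.X ^ 2)
    (Q + Polynomial.C s * Polynomial.X)
  have hdP : Polynomial.derivative (P + Polynomial.C (r / 2) * Polynomial.X ^ 2)
      = Polynomial.C q * 1 + Polynomial.C r * Polynomial.X := by
    simp only [hP, Polynomial.derivative_add, Polynomial.derivative_C_mul,
      Polynomial.derivative_one, Polynomial.derivative_X, Polynomial.derivative_X_pow]
    rw [show Polynomial.C r = Polynomial.C (r / 2) * Polynomial.C (2 : ℝ) by
      rw [← Polynomial.C_mul]; congr 1; ring]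
    simp
    ring
  have hdQ : Polynomial.derivative (Q + Polynomial.C s * Polynomial.X) = Polynomial.C s * 1 := by
    simp [hQ]
  rw [hV, hW, hJP, hJQ, hdP, hdQ, jet_add, jet_C_mul, jet_C_mul, jet_C_mul] at h1
  have h2 : L (t, x, u, q, p) = (t, x, u • e₀ + q • e₁, p • e₀) := rfl
  rw [h2, h1]
  simp [hP, hQ, hR]

/-! ### Divergence of a curl with `C¹` potentials -/

section Curl

theorem hasDerivAt_left {W : ℝ → ℝ → ℝ → ℝ}
    (hW : Differentiable ℝ fun z : ℝ × ℝ × ℝ => W z.1 z.2.1 z.2.2) (t x u : ℝ) :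
    HasDerivAt (fun s => W s x u) (partialT W t x u) t := by
  simpa using hasDerivAt_comp_three hW (hasDerivAt_id t) (hasDerivAt_const t x)
    (hasDerivAt_const t u)

theorem hasDerivAt_middle {W : ℝ → ℝ → ℝ → ℝ}
    (hW : Differentiable ℝ fun z : ℝ × ℝ × ℝ => W z.1 z.2.1 z.2.2) (t x u : ℝ) :
    HasDerivAt (fun y => W t y u) (partialX W t x u) x := by
  simpa using hasDerivAt_comp_three hW (hasDerivAt_const x t) (hasDerivAt_id x)
    (hasDerivAt_const x u)

theorem hasDerivAt_right {W : ℝ → ℝ → ℝ → ℝ}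
    (hW : Differentiable ℝ fun z : ℝ × ℝ × ℝ => W z.1 z.2.1 z.2.2) (t x u : ℝ) :
    HasDerivAt (fun v => W t x v) (partialU W t x u) u := by
  simpa using hasDerivAt_comp_three hW (hasDerivAt_const u t) (hasDerivAt_const u x)
    (hasDerivAt_id u)

theorem continuous_fderiv_apply_right {W : ℝ → ℝ → ℝ → ℝ}
    (hW : ContDiff ℝ 1 fun z : ℝ × ℝ × ℝ => W z.1 z.2.1 z.2.2) (t x : ℝ) (e : ℝ × ℝ × ℝ) :
    Continuous fun s => fderiv ℝ (fun z : ℝ × ℝ × ℝ => W z.1 z.2.1 z.2.2) (t, x, s) e :=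
  ((hW.continuous_fderiv one_ne_zero).comp
    (by fun_prop : Continuous fun s : ℝ => ((t, x, s) : ℝ × ℝ × ℝ))).clm_apply continuous_const

/-- The derivative of a parametric integral of a `C¹` function in one real parameter. -/
theorem hasDerivAt_integral_of_contDiff {f : ℝ × ℝ → ℝ} (hf : ContDiff ℝ 1 f) (a b t : ℝ) :
    HasDerivAt (fun t => ∫ s in a..b, f (t, s)) (∫ s in a..b, fderiv ℝ f (t, s) (1, 0)) t := by
  have h := (hasFDerivAt_parametric_intervalIntegral hf a b t).hasDerivAt
  refine h.congr_deriv ?_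
  have hc : Continuous fun s : ℝ =>
      (fderiv ℝ f (t, s)).comp (ContinuousLinearMap.inl ℝ ℝ ℝ) :=
    ((hf.continuous_fderiv one_ne_zero).comp
      (by fun_prop : Continuous fun s : ℝ => (t, s))).clm_comp continuous_const
  rw [ContinuousLinearMap.intervalIntegral_apply (hc.intervalIntegrable _ _)]
  simp

theorem partialT_primitive {W : ℝ → ℝ → ℝ → ℝ}
    (hW : ContDiff ℝ 1 fun z : ℝ × ℝ × ℝ => W z.1 z.2.1 z.2.2) (t x u : ℝ) :
    partialT (primitive W) t x u = ∫ s in (0 : ℝ)..u, partialT W t x s := by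
  have h1 := hasDerivAt_left ((contDiff_primitive (k := 1) hW).differentiable one_ne_zero) t x u
  have hf : ContDiff ℝ 1 fun z : ℝ × ℝ => W z.1 x z.2 :=
    hW.comp (by fun_prop : ContDiff ℝ 1 fun z : ℝ × ℝ => ((z.1, x, z.2) : ℝ × ℝ × ℝ))
  have h2 := hasDerivAt_integral_of_contDiff hf 0 u t
  refine (h1.unique h2).trans (intervalIntegral.integral_congr fun s _ => ?_)
  have h3 := hasDerivAt_comp_curve (γ := fun r : ℝ => (r, s))
    ((hf.differentiable one_ne_zero) (t, s)) ((hasDerivAt_id t).prodMk (hasDerivAt_const t s))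
  exact h3.unique (hasDerivAt_left (hW.differentiable one_ne_zero) t x s)

theorem partialX_primitive {W : ℝ → ℝ → ℝ → ℝ}
    (hW : ContDiff ℝ 1 fun z : ℝ × ℝ × ℝ => W z.1 z.2.1 z.2.2) (t x u : ℝ) :
    partialX (primitive W) t x u = ∫ s in (0 : ℝ)..u, partialX W t x s := by
  have h1 := hasDerivAt_middle ((contDiff_primitive (k := 1) hW).differentiable one_ne_zero) t x u
  have hf : ContDiff ℝ 1 fun z : ℝ × ℝ => W t z.1 z.2 :=
    hW.comp (by fun_prop : ContDiff ℝ 1 fun z : ℝ × ℝ => ((t, z.1, z.2) : ℝ × ℝ × ℝ))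
  have h2 := hasDerivAt_integral_of_contDiff hf 0 u x
  refine (h1.unique h2).trans (intervalIntegral.integral_congr fun s _ => ?_)
  have h3 := hasDerivAt_comp_curve (γ := fun r : ℝ => (r, s))
    ((hf.differentiable one_ne_zero) (x, s)) ((hasDerivAt_id x).prodMk (hasDerivAt_const x s))
  exact h3.unique (hasDerivAt_middle (hW.differentiable one_ne_zero) t x s)

theorem integral_partialU {W : ℝ → ℝ → ℝ → ℝ}
    (hW : ContDiff ℝ 1 fun z : ℝ × ℝ × ℝ => W z.1 z.2.1 z.2.2) (t x u : ℝ) :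
    ∫ s in (0 : ℝ)..u, partialU W t x s = W t x u - W t x 0 :=
  intervalIntegral.integral_eq_sub_of_hasDerivAt
    (fun s _ => hasDerivAt_right (hW.differentiable one_ne_zero) t x s)
    ((continuous_fderiv_apply_right hW t x _).intervalIntegrable _ _)

end Curl

/-- If a function of two variables has partial derivatives which are differentiable functions,
then its mixed second derivatives agree. -/
theorem mixed_partial_eq {B P Q : ℝ × ℝ → ℝ} (hB : Differentiable ℝ B)
    (hP : Differentiable ℝ P) (hQ : Differentiable ℝ Q)
    (hBP : ∀ z, fderiv ℝ B z (1, 0) = P z) (hBQ : ∀ z, fderiv ℝ B z (0, 1) = Q z) (z : ℝ × ℝ) :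
    fderiv ℝ P z (0, 1) = fderiv ℝ Q z (1, 0) := by
  have hB' : ∀ z, HasFDerivAt B (P z • ContinuousLinearMap.fst ℝ ℝ ℝ
      + Q z • ContinuousLinearMap.snd ℝ ℝ ℝ) z := fun z => by
    refine (hB z).hasFDerivAt.congr_fderiv ?_
    ext <;> simp [hBP, hBQ]
  have hP' := (hP z).hasFDerivAt.smul_const (ContinuousLinearMap.fst ℝ ℝ ℝ)
  have hQ' := (hQ z).hasFDerivAt.smul_const (ContinuousLinearMap.snd ℝ ℝ ℝ)
  simpa using (second_derivative_symmetric hB' (hP'.add hQ') (1, 0) (0, 1)).symm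

/-- The divergence of a curl vanishes, integrated once in `u` so as to make sense for potentials
`A₀`, `A₁`, `B₀` that are merely `C¹`. -/
theorem integrated_div_curl {A₀ A₁ B₀ M₁ M₂ : ℝ → ℝ → ℝ → ℝ}
    (hA₀ : ContDiff ℝ 1 fun z : ℝ × ℝ × ℝ => A₀ z.1 z.2.1 z.2.2)
    (hA₁ : ContDiff ℝ 1 fun z : ℝ × ℝ × ℝ => A₁ z.1 z.2.1 z.2.2)
    (hB₀ : ContDiff ℝ 1 fun z : ℝ × ℝ × ℝ => B₀ z.1 z.2.1 z.2.2)
    (hM₁ : ContDiff ℝ 1 fun z : ℝ × ℝ × ℝ => M₁ z.1 z.2.1 z.2.2)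
    (hM₂ : ContDiff ℝ 1 fun z : ℝ × ℝ × ℝ => M₂ z.1 z.2.1 z.2.2)
    (h₁ : ∀ t x u, M₁ t x u = partialT A₁ t x u + partialU B₀ t x u)
    (h₂ : ∀ t x u, M₂ t x u = partialU A₀ t x u - partialX A₁ t x u) (t x u : ℝ) :
    partialT (primitive M₂) t x u + partialX (primitive M₁) t x u
      = partialT A₀ t x u + partialX B₀ t x u - (partialT A₀ t x 0 + partialX B₀ t x 0) := by
  have dA₀ := hA₀.differentiable one_ne_zero
  have dB₀ := hB₀.differentiable one_ne_zero
  have dA := (contDiff_primitive (k := 1) hA₁).differentiable one_ne_zero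
  have d₁ := (contDiff_primitive (k := 1) hM₁).differentiable one_ne_zero
  have d₂ := (contDiff_primitive (k := 1) hM₂).differentiable one_ne_zero
  have slice : ∀ {W : ℝ → ℝ → ℝ → ℝ},
      (Differentiable ℝ fun z : ℝ × ℝ × ℝ => W z.1 z.2.1 z.2.2) →
      ∀ v, Differentiable ℝ fun z : ℝ × ℝ => W z.1 z.2 v := fun hW v =>
    hW.comp (by fun_prop : Differentiable ℝ fun z : ℝ × ℝ => ((z.1, z.2, v) : ℝ × ℝ × ℝ))
  have pT : ∀ {V : ℝ × ℝ → ℝ} {V' : ℝ} (z : ℝ × ℝ), Differentiable ℝ V →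
      HasDerivAt (fun s => V (s, z.2)) V' z.1 → fderiv ℝ V z (1, 0) = V' := fun z hV h =>
    (hasDerivAt_comp_curve (γ := fun s : ℝ => (s, z.2)) (hV z)
      ((hasDerivAt_id z.1).prodMk (hasDerivAt_const z.1 z.2))).unique h
  have pX : ∀ {V : ℝ × ℝ → ℝ} {V' : ℝ} (z : ℝ × ℝ), Differentiable ℝ V →
      HasDerivAt (fun s => V (z.1, s)) V' z.2 → fderiv ℝ V z (0, 1) = V' := fun z hV h =>
    (hasDerivAt_comp_curve (γ := fun s : ℝ => (z.1, s)) (hV z)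
      ((hasDerivAt_const z.2 z.1).prodMk (hasDerivAt_id z.2))).unique h
  -- For fixed `u`, the two first derivatives of `∫ A₁ du` are expressed through differentiable
  -- functions, although `A₁` is only `C¹`. Equality of its mixed derivatives is the claim.
  have hP : ∀ t x, partialT (primitive A₁) t x u
      = primitive M₁ t x u - (B₀ t x u - B₀ t x 0) := fun t x => by
    rw [partialT_primitive hA₁, ← integral_partialU hB₀, primitive,
      ← intervalIntegral.integral_sub]
    · simp [h₁]
    · exact (hM₁.continuous.comp
        (by fun_prop : Continuous fun s : ℝ => ((t, x, s) : ℝ × ℝ × ℝ))).intervalIntegrable _ _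
    · exact (continuous_fderiv_apply_right hB₀ t x _).intervalIntegrable _ _
  have hQ : ∀ t x, partialX (primitive A₁) t x u
      = A₀ t x u - A₀ t x 0 - primitive M₂ t x u := fun t x => by
    rw [partialX_primitive hA₁, ← integral_partialU hA₀, primitive,
      ← intervalIntegral.integral_sub]
    · simp [h₂]
    · exact (continuous_fderiv_apply_right hA₀ t x _).intervalIntegrable _ _
    · exact (hM₂.continuous.comp
        (by fun_prop : Continuous fun s : ℝ => ((t, x, s) : ℝ × ℝ × ℝ))).intervalIntegrable _ _
  have dP := (slice d₁ u).sub ((slice dB₀ u).sub (slice dB₀ 0))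
  have dQ := ((slice dA₀ u).sub (slice dA₀ 0)).sub (slice d₂ u)
  have key := mixed_partial_eq (slice dA u) dP dQ
    (fun z => (pT z (slice dA u) (hasDerivAt_left dA z.1 z.2 u)).trans (hP z.1 z.2))
    (fun z => (pX z (slice dA u) (hasDerivAt_middle dA z.1 z.2 u)).trans (hQ z.1 z.2)) (t, x)
  rw [pX (t, x) dP ((hasDerivAt_middle d₁ t x u).sub
      ((hasDerivAt_middle dB₀ t x u).sub (hasDerivAt_middle dB₀ t x 0))),
    pT (t, x) dQ (((hasDerivAt_left dA₀ t x u).sub (hasDerivAt_left dA₀ t x 0)).sub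
      (hasDerivAt_left d₂ t x u))] at key
  linarith

/-! ### Necessity: splitting the determining equation -/

/-- The determining equation fixes the dependence of the density on `u_x` and of the flux on `u_x`
and `u_t`, up to three `C¹` functions of `(t, x, u)`. -/
theorem exists_potentials {a b c c₀ c₁ c₂ : ℝ} {g C : ℝ → ℝ → ℝ → ℝ → ℝ}
    {Φ : ℝ × ℝ × ℝ × ℝ × ℝ → ℝ}
    (hC : ContDiff ℝ 1 (fun z : ℝ × ℝ × ℝ × ℝ => C z.1 z.2.1 z.2.2.1 z.2.2.2))
    (hΦ : ContDiff ℝ 1 Φ)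
    (h : ∀ t x u q r p s : ℝ,
      (-c ^ 2 * r + g t x u p) * (Real.exp (a * t + b * x) * (c₁ * p + c₂ * q + c₀ * u))
        = Real.exp (a * t + b * x) * (a * (1 / 2 * c₁ * p ^ 2 + c₂ * q * p + c₀ * u * p)
            + c₂ * s * p + c₀ * p ^ 2)
          + fderiv ℝ (fun z : ℝ × ℝ × ℝ × ℝ => C z.1 z.2.1 z.2.2.1 z.2.2.2) (t, x, u, q)
              (1, 0, p, s)
          + fderiv ℝ Φ (t, x, u, q, p) (0, 1, q, r, s)) :
    ∃ A₀ A₁ B₀ : ℝ → ℝ → ℝ → ℝ,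
      ContDiff ℝ 1 (fun z : ℝ × ℝ × ℝ => A₀ z.1 z.2.1 z.2.2) ∧
      ContDiff ℝ 1 (fun z : ℝ × ℝ × ℝ => A₁ z.1 z.2.1 z.2.2) ∧
      ContDiff ℝ 1 (fun z : ℝ × ℝ × ℝ => B₀ z.1 z.2.1 z.2.2) ∧
      (∀ t x u q, C t x u q = A₀ t x u + A₁ t x u * q
        + 1 / 2 * c ^ 2 * c₁ * q ^ 2 * Real.exp (a * t + b * x)) ∧
      ∀ t x u q p, Φ (t, x, u, q, p) = B₀ t x u - A₁ t x u * p
        - (1 / 2 * c₂ * p ^ 2 + c ^ 2 * ((c₁ * p + c₀ * u) * q + 1 / 2 * c₂ * q ^ 2))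
          * Real.exp (a * t + b * x) := by
  have hCd := hC.differentiable one_ne_zero
  have hΦd := hΦ.differentiable one_ne_zero
  set Cf : ℝ × ℝ × ℝ × ℝ → ℝ := fun z => C z.1 z.2.1 z.2.2.1 z.2.2.2 with hCf
  have hΦq : ∀ t x u q p, HasDerivAt (fun q => Φ (t, x, u, q, p))
      (-(c ^ 2 * (c₁ * p + c₂ * q + c₀ * u) * Real.exp (a * t + b * x))) q := by
    intro t x u q p
    have h1 := hasDerivAt_comp_curve (γ := fun q : ℝ => (t, x, u, q, p)) (hΦd _)
      ((hasDerivAt_const q t).prodMk ((hasDerivAt_const q x).prodMk ((hasDerivAt_const q u).prodMk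
        ((hasDerivAt_id q).prodMk (hasDerivAt_const q p)))))
    refine h1.congr_deriv ?_
    have h2 : ((0, 0, 0, 1, 0) : ℝ × ℝ × ℝ × ℝ × ℝ) = (0, 1, q, 1, 0) - (0, 1, q, 0, 0) := by simp
    rw [h2, map_sub]
    -- The coefficient of `r = u_xx`: `Φ_q = -c² Q`.
    linear_combination h t x u q 0 p 0 - h t x u q 1 p 0
  set D : ℝ → ℝ → ℝ → ℝ → ℝ → ℝ := fun t x u q p =>
    fderiv ℝ Φ (t, x, u, q, p) (0, 0, 0, 0, 1) with hD
  have hΦp : ∀ t x u q p, HasDerivAt (fun p => Φ (t, x, u, q, p)) (D t x u q p) p := by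
    intro t x u q p
    exact hasDerivAt_comp_curve (γ := fun p : ℝ => (t, x, u, q, p)) (hΦd _)
      ((hasDerivAt_const p t).prodMk ((hasDerivAt_const p x).prodMk ((hasDerivAt_const p u).prodMk
        ((hasDerivAt_const p q).prodMk (hasDerivAt_id p)))))
  have hCq : ∀ t x u q p, HasDerivAt (fun q => C t x u q)
      (-(c₂ * p * Real.exp (a * t + b * x)) - D t x u q p) q := by
    intro t x u q p
    have h1 : HasDerivAt (fun q => C t x u q) (fderiv ℝ Cf (t, x, u, q) (0, 0, 0, 1)) q :=
      hasDerivAt_comp_curve (γ := fun q : ℝ => (t, x, u, q)) (hCd _)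
      ((hasDerivAt_const q t).prodMk ((hasDerivAt_const q x).prodMk ((hasDerivAt_const q u).prodMk
        (hasDerivAt_id q))))
    refine h1.congr_deriv ?_
    have h2 : fderiv ℝ Cf (t, x, u, q) (0, 0, 0, 1)
        = fderiv ℝ Cf (t, x, u, q) (1, 0, p, 1) - fderiv ℝ Cf (t, x, u, q) (1, 0, p, 0) := by
      rw [← map_sub]
      simp
    have h3 : D t x u q p = fderiv ℝ Φ (t, x, u, q, p) (0, 1, q, 0, 1)
        - fderiv ℝ Φ (t, x, u, q, p) (0, 1, q, 0, 0) := by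
      rw [← map_sub]
      simp [hD]
    rw [h2, h3]
    -- The coefficient of `s = u_tx`: `C_q + Φ_p = -c₂ p e^{at+bx}`.
    linear_combination h t x u q 0 p 0 - h t x u q 0 p 1
  have hΦ0 : ∀ t x u q p, Φ (t, x, u, q, p) = Φ (t, x, u, 0, p)
      - c ^ 2 * ((c₁ * p + c₀ * u) * q + 1 / 2 * c₂ * q ^ 2) * Real.exp (a * t + b * x) := by
    intro t x u q p
    have h1 : ∀ q, HasDerivAt (fun q => Φ (t, x, u, q, p)
        + (c ^ 2 * Real.exp (a * t + b * x)) * ((c₁ * p + c₀ * u) * q + 1 / 2 * c₂ * q ^ 2)) 0 q := by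
      intro q
      refine ((hΦq t x u q p).add ((((hasDerivAt_id q).const_mul (c₁ * p + c₀ * u)).add
        (((hasDerivAt_id q).pow 2).const_mul (1 / 2 * c₂))).const_mul _)).congr_deriv ?_
      simp
      ring
    have h2 := eq_of_hasDerivAt_zero h1 q 0
    linear_combination h2
  have hDq : ∀ t x u q p, D t x u q p
      = D t x u 0 p - c ^ 2 * c₁ * q * Real.exp (a * t + b * x) := by
    intro t x u q p
    refine (hΦp t x u q p).unique ?_
    rw [funext fun p => hΦ0 t x u q p]
    refine ((hΦp t x u 0 p).sub ((((((hasDerivAt_id p).const_mul c₁).add_const (c₀ * u)).mul_const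
      q).add_const (1 / 2 * c₂ * q ^ 2)).const_mul (c ^ 2) |>.mul_const
        (Real.exp (a * t + b * x)))).congr_deriv ?_
    ring
  have hC0 : ∀ t x u q, C t x u q = C t x u 0 - D t x u 0 0 * q
      + 1 / 2 * c ^ 2 * c₁ * q ^ 2 * Real.exp (a * t + b * x) := by
    intro t x u q
    have h1 : ∀ q, HasDerivAt (fun q => C t x u q + D t x u 0 0 * q
        - (c ^ 2 * c₁ * Real.exp (a * t + b * x) / 2) * q ^ 2) 0 q := by
      intro q
      refine (((hCq t x u q 0).add ((hasDerivAt_id q).const_mul (D t x u 0 0))).sub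
        (((hasDerivAt_id q).pow 2).const_mul _)).congr_deriv ?_
      rw [hDq]
      simp
      ring
    have h2 := eq_of_hasDerivAt_zero h1 q 0
    linear_combination h2
  -- This equals `-Φ_p` at `q = p = 0`, a priori merely continuous. Expressed through values of `C`
  -- at `q = 0, 1` it is visibly `C¹`.
  set A₁ : ℝ → ℝ → ℝ → ℝ := fun t x u =>
    C t x u 1 - C t x u 0 - 1 / 2 * c ^ 2 * c₁ * Real.exp (a * t + b * x) with hA₁
  have hA₁D : ∀ t x u, D t x u 0 0 = -A₁ t x u := fun t x u => by
    simp only [hA₁]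
    rw [hC0 t x u 1]
    ring
  have hD0 : ∀ t x u p, D t x u 0 p = -A₁ t x u - c₂ * p * Real.exp (a * t + b * x) := by
    intro t x u p
    rw [← hA₁D]
    -- `C_q` does not depend on `p`.
    linear_combination (hCq t x u 0 0).unique (hCq t x u 0 p)
  have hslice : ∀ q : ℝ, ContDiff ℝ 1 fun z : ℝ × ℝ × ℝ => C z.1 z.2.1 z.2.2 q := fun q =>
    hC.comp (by fun_prop : ContDiff ℝ 1 fun z : ℝ × ℝ × ℝ => (z.1, z.2.1, z.2.2, q))
  refine ⟨fun t x u => C t x u 0, A₁, fun t x u => Φ (t, x, u, 0, 0), hslice 0, ?_, ?_, ?_, ?_⟩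
  · exact ((hslice 1).sub (hslice 0)).sub (by fun_prop)
  · exact hΦ.comp (by fun_prop : ContDiff ℝ 1 fun z : ℝ × ℝ × ℝ =>
      ((z.1, z.2.1, z.2.2, 0, 0) : ℝ × ℝ × ℝ × ℝ × ℝ))
  · intro t x u q
    rw [hC0 t x u q, hA₁D]
    ring
  · intro t x u q p
    have h1 : ∀ p, HasDerivAt (fun p => Φ (t, x, u, 0, p) + A₁ t x u * p
        + (c₂ * Real.exp (a * t + b * x) / 2) * p ^ 2) 0 p := by
      intro p
      refine (((hΦp t x u 0 p).add ((hasDerivAt_id p).const_mul (A₁ t x u))).add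
        (((hasDerivAt_id p).pow 2).const_mul _)).congr_deriv ?_
      rw [hD0]
      simp
      ring
    have h2 := eq_of_hasDerivAt_zero h1 p 0
    rw [hΦ0]
    linear_combination h2

/-- The determining equation as an identity that is polynomial in `q = u_x`. -/
theorem exists_determining_equation {k : ℕ∞} (hk : 1 ≤ k) {a b c c₀ c₁ c₂ : ℝ}
    {g C : ℝ → ℝ → ℝ → ℝ → ℝ} {N : ℕ}
    {Ψ : ℝ → ℝ → (Fin (N + 1) → ℝ) → (Fin (N + 1) → ℝ) → ℝ}
    (hC : ContDiff ℝ k (fun z : ℝ × ℝ × ℝ × ℝ => C z.1 z.2.1 z.2.2.1 z.2.2.2))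
    (hΨ : ContDiff ℝ k (fun z : ℝ × ℝ × (Fin (N + 1) → ℝ) × (Fin (N + 1) → ℝ) =>
      Ψ z.1 z.2.1 z.2.2.1 z.2.2.2))
    (h : ∀ u : ℝ → ℝ → ℝ, SmoothField u → ∀ t x : ℝ,
      waveExpr c g u t x * multiplier a b c₀ c₁ c₂ u t x
        = dt (density a b c₀ c₁ c₂ C u) t x + dx (flux Ψ u) t x) :
    ∃ A₀ A₁ B₀ : ℝ → ℝ → ℝ → ℝ,
      ContDiff ℝ 1 (fun z : ℝ × ℝ × ℝ => A₀ z.1 z.2.1 z.2.2) ∧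
      ContDiff ℝ 1 (fun z : ℝ × ℝ × ℝ => A₁ z.1 z.2.1 z.2.2) ∧
      ContDiff ℝ 1 (fun z : ℝ × ℝ × ℝ => B₀ z.1 z.2.1 z.2.2) ∧
      ∀ t x u q p, g t x u p * Real.exp (a * t + b * x) * (c₁ * p + c₂ * q + c₀ * u)
        = Real.exp (a * t + b * x) * ((1 / 2 * a * c₁ + c₀ - 1 / 2 * b * c₂) * p ^ 2
            + (a * c₂ - c ^ 2 * b * c₁) * q * p + a * c₀ * u * p - c ^ 2 * b * c₀ * u * q
            + c ^ 2 * (1 / 2 * a * c₁ - 1 / 2 * b * c₂ - c₀) * q ^ 2)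
          + (partialT A₁ t x u + partialU B₀ t x u) * q
          + (partialU A₀ t x u - partialX A₁ t x u) * p
          + (partialT A₀ t x u + partialX B₀ t x u) := by
  obtain ⟨Φ, hΦ, hdet⟩ := exists_low_order_flux hk hC hΨ h
  have hC1 := hC.of_le (m := 1) (by exact_mod_cast hk)
  obtain ⟨A₀, A₁, B₀, hA₀, hA₁, hB₀, hCA, hΦA⟩ := exists_potentials hC1 hΦ hdet
  have dA₀ := hA₀.differentiable one_ne_zero
  have dA₁ := hA₁.differentiable one_ne_zero
  have dB₀ := hB₀.differentiable one_ne_zero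
  refine ⟨A₀, A₁, B₀, hA₀, hA₁, hB₀, fun t x u q p => ?_⟩
  have hlin : ∀ y z w : ℝ, HasDerivAt (fun τ => y + (τ - w) * z) z w := fun y z w => by
    simpa using (((hasDerivAt_id w).sub_const w).mul_const z).const_add y
  have eC : fderiv ℝ (fun z : ℝ × ℝ × ℝ × ℝ => C z.1 z.2.1 z.2.2.1 z.2.2.2) (t, x, u, q)
      (1, 0, p, 0) = partialT A₀ t x u + partialU A₀ t x u * p
        + (partialT A₁ t x u + partialU A₁ t x u * p) * q
        + 1 / 2 * c ^ 2 * c₁ * q ^ 2 * (Real.exp (a * t + b * x) * a) := by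
    have h1 := hasDerivAt_comp_curve (F := fun z : ℝ × ℝ × ℝ × ℝ => C z.1 z.2.1 z.2.2.1 z.2.2.2)
      (γ := fun s : ℝ => (s, x, u + (s - t) * p, q)) ((hC1.differentiable one_ne_zero) _)
      ((hasDerivAt_id t).prodMk ((hasDerivAt_const t x).prodMk ((hlin u p t).prodMk
        (hasDerivAt_const t q))))
    have e0 : HasDerivAt (fun s => Real.exp (a * s + b * x))
        (Real.exp (a * t + b * x) * a) t := by
      simpa using (((hasDerivAt_id t).const_mul a).add_const (b * x)).exp
    have h2 := ((hasDerivAt_comp_three dA₀ (hasDerivAt_id t) (hasDerivAt_const t x)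
      (hlin u p t)).add ((hasDerivAt_comp_three dA₁ (hasDerivAt_id t) (hasDerivAt_const t x)
      (hlin u p t)).mul_const q)).add (e0.const_mul (1 / 2 * c ^ 2 * c₁ * q ^ 2))
    simp only [hCA] at h1
    have h3 := h1.unique h2
    simp only [sub_self, zero_mul, add_zero, mul_one, mul_zero, id] at h3
    simpa only [hCA] using h3
  have eΦ : fderiv ℝ Φ (t, x, u, q, p) (0, 1, q, 0, 0)
      = partialX B₀ t x u + partialU B₀ t x u * q
        - (partialX A₁ t x u + partialU A₁ t x u * q) * p
        - ((1 / 2 * c₂ * p ^ 2 + c ^ 2 * ((c₁ * p + c₀ * u) * q + 1 / 2 * c₂ * q ^ 2))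
            * (Real.exp (a * t + b * x) * b)
          + c ^ 2 * (c₀ * q * q) * Real.exp (a * t + b * x)) := by
    have h1 := hasDerivAt_comp_curve (F := Φ)
      (γ := fun y : ℝ => (t, y, u + (y - x) * q, q, p)) ((hΦ.differentiable one_ne_zero) _)
      ((hasDerivAt_const x t).prodMk ((hasDerivAt_id x).prodMk ((hlin u q x).prodMk
        ((hasDerivAt_const x q).prodMk (hasDerivAt_const x p)))))
    have e0 : HasDerivAt (fun y => Real.exp (a * t + b * y))
        (Real.exp (a * t + b * x) * b) x := by
      simpa using (((hasDerivAt_id x).const_mul b).const_add (a * t)).exp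
    have h2 := ((hasDerivAt_comp_three dB₀ (hasDerivAt_const x t) (hasDerivAt_id x)
      (hlin u q x)).sub ((hasDerivAt_comp_three dA₁ (hasDerivAt_const x t) (hasDerivAt_id x)
      (hlin u q x)).mul_const p)).sub (((((((hlin u q x).const_mul c₀).const_add
        (c₁ * p)).mul_const q).add_const (1 / 2 * c₂ * q ^ 2)).const_mul (c ^ 2)
          |>.const_add (1 / 2 * c₂ * p ^ 2)).mul e0)
    simp only [hΦA] at h1
    have h3 := h1.unique h2
    simp only [sub_self, zero_mul, add_zero, mul_one, mul_zero, zero_add, id] at h3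
    linear_combination h3
  have h0 := hdet t x u q 0 p 0
  rw [eC, eΦ] at h0
  linear_combination h0

/-- Splitting the determining equation with respect to `u_x` and `u_t`: the damping is linear with
a constant coefficient. -/
theorem linear_damping_of_determining_equation {a b c c₀ c₁ c₂ : ℝ} (hc : c ≠ 0)
    (hne : ¬ (c₀ = 0 ∧ c₁ = 0 ∧ c₂ = 0)) {g : ℝ → ℝ → ℝ → ℝ → ℝ}
    (hg : ∀ t x u, Continuous (g t x u)) {w X Y Z : ℝ → ℝ → ℝ → ℝ}
    (hw : ∀ t x u, w t x u ≠ 0)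
    (h : ∀ t x u q p, g t x u p * w t x u * (c₁ * p + c₂ * q + c₀ * u)
        = w t x u * ((1 / 2 * a * c₁ + c₀ - 1 / 2 * b * c₂) * p ^ 2
            + (a * c₂ - c ^ 2 * b * c₁) * q * p + a * c₀ * u * p - c ^ 2 * b * c₀ * u * q
            + c ^ 2 * (1 / 2 * a * c₁ - 1 / 2 * b * c₂ - c₀) * q ^ 2)
          + X t x u * q + Y t x u * p + Z t x u) :
    ∃ α : ℝ, (∀ t x u p, g t x u p = α * p + g t x u 0) ∧ ¬ (c₁ = 0 ∧ c₂ = 0) ∧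
      α * c₁ = 2 * c₀ ∧ a * c₁ - b * c₂ = 2 * c₀ ∧ α * c₂ = a * c₂ - c ^ 2 * b * c₁ ∧
      (∀ t x u, w t x u * (c₂ * g t x u 0 + c ^ 2 * b * c₀ * u) = X t x u) ∧
      (∀ t x u, w t x u * (c₁ * g t x u 0 + (α - a) * c₀ * u) = Y t x u) ∧
      ∀ t x u, w t x u * (c₀ * u * g t x u 0) = Z t x u := by
  have hq2 : a * c₁ - b * c₂ = 2 * c₀ := by
    have h1 : w 0 0 0 * c ^ 2 * (a * c₁ - b * c₂ - 2 * c₀) = 0 := by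
      linear_combination 2 * h 0 0 0 0 0 - h 0 0 0 1 0 - h 0 0 0 (-1) 0
    have h2 := (mul_eq_zero.1 h1).resolve_left (mul_ne_zero (hw _ _ _) (pow_ne_zero 2 hc))
    linarith
  have hq1 : ∀ t x u p, g t x u p * w t x u * c₂
      = w t x u * ((a * c₂ - c ^ 2 * b * c₁) * p - c ^ 2 * b * c₀ * u) + X t x u := by
    intro t x u p
    linear_combination 1 / 2 * h t x u 1 p - 1 / 2 * h t x u (-1) p
  have hq0 : ∀ t x u p, g t x u p * w t x u * (c₁ * p + c₀ * u)
      = w t x u * (2 * c₀ * p ^ 2 + a * c₀ * u * p) + Y t x u * p + Z t x u := by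
    intro t x u p
    linear_combination h t x u 0 p + 1 / 2 * w t x u * p ^ 2 * hq2
  by_cases hc2 : c₂ = 0
  · subst hc2
    have hc1 : c₁ ≠ 0 := by
      rintro rfl
      exact hne ⟨by linarith, rfl, rfl⟩
    have hb : b = 0 := by
      have h1 : w 0 0 0 * c ^ 2 * c₁ * b = 0 := by
        linear_combination hq1 0 0 0 1 - hq1 0 0 0 0
      exact (mul_eq_zero.1 h1).resolve_left
        (mul_ne_zero (mul_ne_zero (hw _ _ _) (pow_ne_zero 2 hc)) hc1)
    subst hb
    have hac : a * c₁ = 2 * c₀ := by linarith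
    have hfac : ∀ t x u p, (g t x u p - a * p) * w t x u * (c₁ * p + c₀ * u)
        = Y t x u * p + Z t x u := by
      intro t x u p
      linear_combination hq0 t x u p - w t x u * p ^ 2 * hac
    -- At the zero `p₀` of the multiplier the left-hand side of `hfac` vanishes, so `Y p + Z = Y (p
    -- - p₀)`. Division by `p - p₀` is legitimate off `p₀`, and continuity of `g` in `p` covers `p₀`
    -- itself.
    have hY : ∀ t x u p, (g t x u p - a * p) * w t x u * c₁ = Y t x u := by
      intro t x u
      set p₀ := -(c₀ * u) / c₁ with hp₀
      have hp : c₁ * p₀ = -(c₀ * u) := by rw [hp₀]; field_simp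
      have hZ : Z t x u = -(Y t x u * p₀) := by
        linear_combination (g t x u p₀ - a * p₀) * w t x u * hp - hfac t x u p₀
      have hcont : Continuous fun p => (g t x u p - a * p) * w t x u * c₁ := by
        have := hg t x u
        fun_prop
      refine congrFun (hcont.ext_on (dense_compl_singleton p₀) continuous_const fun p hpp => ?_)
      have hpp' : p - p₀ ≠ 0 := sub_ne_zero.2 hpp
      refine mul_right_cancel₀ hpp' ?_
      linear_combination hfac t x u p + hZ - (g t x u p - a * p) * w t x u * hp
    refine ⟨a, fun t x u p => ?_, fun h => hc1 h.1, hac, hq2, by ring, fun t x u => ?_,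
      fun t x u => ?_, fun t x u => ?_⟩
    · refine mul_right_cancel₀ (mul_ne_zero (hw t x u) hc1) ?_
      linear_combination hY t x u p - hY t x u 0
    · linear_combination hq1 t x u 0
    · linear_combination hY t x u 0
    · linear_combination hq0 t x u 0
  -- With `c₂ ≠ 0` the coefficient of `q` alone shows that `g` is affine in `p`, with this slope.
  · set α := (a * c₂ - c ^ 2 * b * c₁) / c₂ with hα
    have hαc : α * c₂ = a * c₂ - c ^ 2 * b * c₁ := div_mul_cancel₀ _ hc2
    have hlin : ∀ t x u p, g t x u p = α * p + g t x u 0 := by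
      intro t x u p
      refine mul_right_cancel₀ (mul_ne_zero (hw t x u) hc2) ?_
      linear_combination hq1 t x u p - hq1 t x u 0 - w t x u * p * hαc
    have hq0' : ∀ t x u p, (α * p + g t x u 0) * w t x u * (c₁ * p + c₀ * u)
        = w t x u * (2 * c₀ * p ^ 2 + a * c₀ * u * p) + Y t x u * p + Z t x u := by
      intro t x u p
      rw [← hlin]
      exact hq0 t x u p
    refine ⟨α, hlin, fun h => hc2 h.2, ?_, hq2, hαc, fun t x u => ?_, fun t x u => ?_,
      fun t x u => ?_⟩
    · refine mul_left_cancel₀ (hw 0 0 0) ?_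
      linear_combination 1 / 2 * hq0' 0 0 0 1 + 1 / 2 * hq0' 0 0 0 (-1) - hq0' 0 0 0 0
    · linear_combination hq1 t x u 0
    · linear_combination 1 / 2 * hq0' t x u 1 - 1 / 2 * hq0' t x u (-1)
    · linear_combination hq0 t x u 0

/-- An energy-momentum type conservation law forces linear damping with a constant coefficient and
a symmetry of the undamped nonlinearity. -/
theorem symmetry_of_hasEnergyMomentumLaw {k : ℕ∞} (hk : 1 ≤ k) {c : ℝ} (hc : c ≠ 0)
    {g : ℝ → ℝ → ℝ → ℝ → ℝ} (hg : NonSingular k g) (h : HasEnergyMomentumLaw k c g) :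
    ∃ α : ℝ, (∀ t x u p, g t x u p = α * p + g t x u 0) ∧
      HasEnergyMomentumSymmetry c (undampedNonlinearity α fun t x u => g t x u 0) := by
  obtain ⟨a, b, c₀, c₁, c₂, C, N, Ψ, hne, hC, hΨ, hlaw⟩ := h
  obtain ⟨A₀, A₁, B₀, hA₀, hA₁, hB₀, hdet⟩ := exists_determining_equation hk hC hΨ hlaw
  have hg1 : ContDiff ℝ 1 fun z : ℝ × ℝ × ℝ × ℝ => g z.1 z.2.1 z.2.2.1 z.2.2.2 :=
    ContDiff.of_le hg (by exact_mod_cast hk)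
  have hgc : ∀ t x u, Continuous (g t x u) := fun t x u =>
    hg1.continuous.comp (by fun_prop : Continuous fun p : ℝ => ((t, x, u, p) : ℝ × ℝ × ℝ × ℝ))
  obtain ⟨α, hlin, hne', hα₁, hac, hα₂, hX, hY, hZ⟩ :=
    linear_damping_of_determining_equation (a := a) (b := b) hc hne hgc
      (w := fun t x _ => Real.exp (a * t + b * x)) (fun _ _ _ => Real.exp_ne_zero _) hdet
  -- Passing from `u` to `v` lowers the exponent `a` by `α`, inverse to the shift `A + α` in the
  -- sufficiency part.
  refine ⟨α, hlin, a - α, b, c₁, c₂, hne', by linarith, by linarith, ?_⟩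
  set f : ℝ → ℝ → ℝ → ℝ := fun t x u => g t x u 0 with hf
  have hf1 : ContDiff ℝ 1 fun z : ℝ × ℝ × ℝ => f z.1 z.2.1 z.2.2 :=
    hg1.comp (by fun_prop : ContDiff ℝ 1 fun z : ℝ × ℝ × ℝ =>
      ((z.1, z.2.1, z.2.2, 0) : ℝ × ℝ × ℝ × ℝ))
  refine (symmetry_iff_pde hf1 α b c₁ c₂).2 fun t x u => ?_
  have dF := (contDiff_primitive (k := 1) hf1).differentiable one_ne_zero
  have hM : ∀ κ l : ℝ, ContDiff ℝ 1 fun z : ℝ × ℝ × ℝ =>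
      Real.exp (a * z.1 + b * z.2.1) * (κ * f z.1 z.2.1 z.2.2 + l * z.2.2) := fun κ l => by
    fun_prop
  have hM' : ∀ κ l : ℝ, ContDiff ℝ 1 fun z : ℝ × ℝ × ℝ => primitive
      (fun t x u => Real.exp (a * t + b * x) * (κ * f t x u + l * u)) z.1 z.2.1 z.2.2 := fun κ l =>
    contDiff_primitive (k := 1)
      (f := fun t x u => Real.exp (a * t + b * x) * (κ * f t x u + l * u)) (hM κ l)
  have hprim : ∀ κ l : ℝ, primitive (fun t x u => Real.exp (a * t + b * x) * (κ * f t x u + l * u))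
      = fun t x u => Real.exp (a * t + b * x) * (κ * primitive f t x u + l / 2 * u ^ 2) := by
    intro κ l
    funext t x u
    have h1 : ∀ u, HasDerivAt (fun u =>
        primitive (fun t x u => Real.exp (a * t + b * x) * (κ * f t x u + l * u)) t x u
          - Real.exp (a * t + b * x) * (κ * primitive f t x u + l / 2 * u ^ 2)) 0 u := by
      intro u
      refine ((hasDerivAt_primitive (hM κ l).continuous t x u).sub
        ((((hasDerivAt_primitive hf1.continuous t x u).const_mul κ).add
          (((hasDerivAt_id u).pow 2).const_mul (l / 2))).const_mul _)).congr_deriv ?_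
      simp
      ring
    have h2 := eq_of_hasDerivAt_zero h1 u 0
    simp only [primitive_zero] at h2
    linear_combination h2
  have key := integrated_div_curl hA₀ hA₁ hB₀ (hM c₂ (c ^ 2 * b * c₀)) (hM c₁ ((α - a) * c₀))
    (fun t x u => hX t x u) (fun t x u => hY t x u) t x u
  have hpX := (hasDerivAt_middle ((hM' c₂ (c ^ 2 * b * c₀)).differentiable one_ne_zero) t x u)
  have hpT := (hasDerivAt_left ((hM' c₁ ((α - a) * c₀)).differentiable one_ne_zero) t x u)
  have e0 : HasDerivAt (fun s => Real.exp (a * s + b * x)) (Real.exp (a * t + b * x) * a) t := by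
    simpa using (((hasDerivAt_id t).const_mul a).add_const (b * x)).exp
  have e1 : HasDerivAt (fun y => Real.exp (a * t + b * y)) (Real.exp (a * t + b * x) * b) x := by
    simpa using (((hasDerivAt_id x).const_mul b).const_add (a * t)).exp
  -- The second use of `hZ` is at `u = 0`, where the factor `u` makes the boundary term vanish.
  rw [← hZ, ← hZ, hpX.unique (by
      rw [hprim]
      exact e1.mul (((hasDerivAt_middle dF t x u).const_mul c₂).add_const _)),
    hpT.unique (by
      rw [hprim]
      exact e0.mul (((hasDerivAt_left dF t x u).const_mul c₁).add_const _))] at key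
  refine mul_left_cancel₀ (Real.exp_ne_zero (a * t + b * x)) ?_
  linear_combination key + Real.exp (a * t + b * x) * (primitive f t x u * (hα₁ - hac)
    - 1 / 2 * u * f t x u * hα₁ + u ^ 2 * (-α / 4 * (a * (hα₁ - hac) + b * hα₂)
      + 1 / 4 * (a * (α - a) + c ^ 2 * b ^ 2) * hα₁))

end DampedWave

end

theorem theorem2 (k : ℕ∞) (hk : 1 ≤ k) (c : ℝ) (hc : 0 < c) (g : ℝ → ℝ → ℝ → ℝ → ℝ)
    (hg : DampedWave.NonSingular k g) (hdamp : DampedWave.HasDamping g) :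
    DampedWave.HasEnergyMomentumLaw k c g ↔
      ∃ α : ℝ, DampedWave.HasLinearDamping α g ∧
        ∃ G : ℝ → ℝ → ℝ → ℝ,
          DampedWave.EnergyMomentumForm c G ∧ DampedWave.MapsToUndamped c α g G := by
  constructor
  · intro h
    obtain ⟨α, hlin, hsym⟩ := DampedWave.symmetry_of_hasEnergyMomentumLaw hk hc.ne' hg h
    exact ⟨α, ⟨_, hlin⟩, _, (DampedWave.energyMomentumForm_iff hc _).2 hsym,
      (DampedWave.mapsToUndamped_iff hlin _).2 rfl⟩
  · rintro ⟨α, ⟨f, hf⟩, G, hform, hmap⟩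
    -- `G` is forced to be the computed nonlinearity. No regularity of `f` is given, but `f` is `g`
    -- at `u_t = 0` and so inherits `C^k`.
    obtain rfl := (DampedWave.mapsToUndamped_iff hf G).1 hmap
    refine DampedWave.hasEnergyMomentumLaw_of_symmetry hk ?_ hf
      ((DampedWave.energyMomentumForm_iff hc _).1 hform)
    have h0 : f = fun t x u => g t x u 0 := by
      funext t x u
      simp [hf]
    rw [h0]
    exact ContDiff.comp hg (by fun_prop : ContDiff ℝ k fun z : ℝ × ℝ × ℝ =>
      ((z.1, z.2.1, z.2.2, 0) : ℝ × ℝ × ℝ × ℝ))
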